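/- **Setting.** Let $d\ge 1$, $m\ge 0$, $\Theta\subseteq\mathbb R^{m}$, and let $\theta\mapsto\mu_\theta$ be a map from $\Theta$ to the Borel probability measures on $\mathbb R^d$. Let $X_1,X_2,\dots$ be $\mathbb R^d$-valued random variables on a probability space $(\Omega,\mathbb P)$, with empirical measures $\widehat\mu_n=\frac1n\sum_{i=1}^n\delta_{X_i}$, and let $\mu_\star$ be a Borel probability measure on $\mathbb R^d$. Write $\mathcal W_1$ for the Wasserstein distance of order $1$ (with values in $[0,\infty]$) and $$\overline{\mathcal{PW}}_{1,1}(\mu,\nu)=\sup_{E\in\mathbb R^{d\times 1},\,E^\top E=1}\mathcal W_1\big((x\mapsto E^\top x)_\#\mu,(x\mapsto E^\top x)_\#\nu\big).$$ For $u\in\mathbb S^{d-1}$, $t\in\mathbb R$ put $F_\theta(u,t)=\mu_\theta\{x:\langle u,x\rangle\le t\}$, $F_\star(u,t)=\mu_\star\{x:\langle u,x\rangle\le t\}$, $\widehat F_n(u,t)=\frac1n|\{i\le n:\langle u,X_i\rangle\le t\}|$, and $\|f\|_L=\sup_{u\in\mathbb S^{d-1}}\int_{\mathbb R}|f(u,t)|\,dt\in[0,\infty]$.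 Let $L$ be the normed space of (classes, up to equality for almost every $t$, of) functions $f$ on $\mathbb S^{d-1}\times\mathbb R$ such that $f(u,\cdot)\in L^1(\mathbb R)$ for all $u$ and $u\mapsto f(u,\cdot)\in L^1(\mathbb R)$ is continuous, with norm $\|\cdot\|_L$ and its Borel $\sigma$-algebra. **Assumptions.** 1. $\mathcal W_1(\widehat\mu_n,\mu_\star)\to0$ almost surely. 2. $\theta\mapsto\mu_\theta$ is continuous on $\Theta$ for weak convergence of measures. 3. For some $\tau>0$ the set $\{\theta\in\Theta:\overline{\mathcal{PW}}_{1,1}(\mu_\star,\mu_\theta)\le\inf_{\theta'\in\Theta}\overline{\mathcal{PW}}_{1,1}(\mu_\star,\mu_{\theta'})+\tau\}$ is bounded. 4. (Well specified) $\mu_\star=\mu_{\theta_\star}$ for some $\theta_\star$ in the interior of $\Theta$. 5. (Separated) For every $\epsilon>0$ there is $\delta>0$ with $\inf_{\theta\in\Theta,\ \|\theta-\theta_\star\|\ge\epsilon}\overline{\mathcal{PW}}_{1,1}(\mu_{\theta_\star},\mu_\theta)>\delta$ (where $\inf\emptyset=+\infty$). 6. (Nonsingular derivative) $D_\star:\mathbb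 S^{d-1}\times\mathbb R\to\mathbb R^{m}$ is measurable, $\|F_\theta-F_{\theta_\star}-\langle\theta-\theta_\star,D_\star\rangle\|_L=o(\|\theta-\theta_\star\|)$ as $\theta\to\theta_\star$ in $\Theta$, and $\|\langle h,D_\star\rangle\|_L=0$ only for $h=0$. 7. $G_\star$ is a random element of $L$ (possibly on another probability space), and the processes $\sqrt n(\widehat F_n-F_\star)$, as random elements of $L$, converge weakly to $G_\star$. **Theorem.** For $n\ge1$ the infimum $\inf_{\theta\in\Theta}\overline{\mathcal{PW}}_{1,1}(\widehat\mu_n,\mu_\theta)$ is finite, so is the limit below, and as $n\to\infty$ $$\sqrt n\inf_{\theta\in\Theta}\overline{\mathcal{PW}}_{1,1}(\widehat\mu_n,\mu_\theta)\ \Rightarrow\ \inf_{\theta\in\mathbb R^{m}}\ \max_{u\in\mathbb S^{d-1}}\int_{\mathbb R}\big|G_\star(u,t)-\langle\theta,D_\star(u,t)\rangle\big|\,dt .$$ Suppose moreover that, almost surely, the random map $\theta\mapsto\max_{u\in\mathbb S^{d-1}}\int_{\mathbb R}|G_\star(u,t)-\langle\theta,D_\star(u,t)\rangle|\,dt$ on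 $\mathbb R^{m}$ has a unique minimizer. Let $\widehat\theta_n:\Omega\to\Theta$ be measurable with $\widehat\theta_n(\omega)\in\operatorname{argmin}_{\theta\in\Theta}\overline{\mathcal{PW}}_{1,1}(\widehat\mu_n(\omega),\mu_\theta)$ whenever this set is nonempty. Then $$\sqrt n(\widehat\theta_n-\theta_\star)\ \Rightarrow\ \operatorname*{argmin}_{\theta\in\mathbb R^{m}}\ \max_{u\in\mathbb S^{d-1}}\int_{\mathbb R}\big|G_\star(u,t)-\langle\theta,D_\star(u,t)\rangle\big|\,dt .$$ Here the maximum over $u$ is understood as the supremum in $[0,\infty]$, and $\Rightarrow$ is convergence in distribution in $\mathbb R$, respectively $\mathbb R^m$. -/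

import Mathlib

open MeasureTheory ProbabilityTheory Filter Topology
open scoped ENNReal

noncomputable section

namespace PRW

/-- `ℝ^n` with its Euclidean norm. -/
abbrev E (n : ℕ) : Type := EuclideanSpace ℝ (Fin n)

/-- The unit sphere `𝕊^{d-1}` of `ℝ^d`. -/
abbrev Sph (d : ℕ) : Type := Metric.sphere (0 : E d) 1

/-- `π` is a coupling of `μ` and `ν`: its marginals are `μ` and `ν`. -/
def IsCoupling {α : Type*} [MeasurableSpace α] (μ ν : Measure α) (π : Measure (α × α)) : Prop :=
  π.map Prod.fst = μ ∧ π.map Prod.snd = ν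

/-- The Wasserstein distance of order `p`, with values in `[0, ∞]`. -/
def wasserstein {α : Type*} [MeasurableSpace α] [PseudoEMetricSpace α] (p : ℝ)
    (μ ν : Measure α) : ℝ≥0∞ :=
  (⨅ (π : Measure (α × α)) (_ : IsCoupling μ ν π), ∫⁻ z, edist z.1 z.2 ^ p ∂π) ^ (1 / p)

/-- The linear map `x ↦ Aᵀ x` from `ℝ^d` to `ℝ^k` attached to a `d × k` matrix `A`. -/
def proj {d k : ℕ} (A : Matrix (Fin d) (Fin k) ℝ) (x : E d) : E k :=
  WithLp.toLp 2 (A.transpose.mulVec (WithLp.ofLp x))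

/-- The projection robust Wasserstein distance of order `p` with projection dimension `k`: the
supremum over the `d × k` matrices `A` with orthonormal columns of the Wasserstein distance of
order `p` between the images of the two measures under `x ↦ Aᵀ x`. -/
def prw {d : ℕ} (p : ℝ) (k : ℕ) (μ ν : Measure (E d)) : ℝ≥0∞ :=
  ⨆ (A : Matrix (Fin d) (Fin k) ℝ) (_ : A.transpose * A = 1),
    wasserstein p (μ.map (proj A)) (ν.map (proj A))

/-- The empirical measure `(1/n) ∑_{i < n} δ_{x i}`. -/
def empirical {d : ℕ} (n : ℕ) (x : ℕ → E d) : Measure (E d) :=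
  (n : ℝ≥0∞)⁻¹ • ∑ i ∈ Finset.range n, Measure.dirac (x i)

/-- `F_μ(u, t) = μ {x : ⟨u, x⟩ ≤ t}`, the distribution functions of the one-dimensional
projections of `μ`. -/
def projCDF {d : ℕ} (μ : Measure (E d)) (u : Sph d) (t : ℝ) : ℝ :=
  μ.real {x | inner ℝ (u : E d) x ≤ t}

/-- The empirical version `F̂_n(u, t) = (1/n) |{i < n : ⟨u, x i⟩ ≤ t}|`. -/
def empCDF {d : ℕ} (n : ℕ) (x : ℕ → E d) (u : Sph d) (t : ℝ) : ℝ :=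
  (n : ℝ)⁻¹ * ((Finset.range n).filter (fun i => inner ℝ (u : E d) (x i) ≤ t)).card

/-- `‖f‖_L = sup_u ∫ |f(u, t)| dt`, with values in `[0, ∞]`. -/
def normL {d : ℕ} (f : Sph d → ℝ → ℝ) : ℝ≥0∞ :=
  ⨆ u : Sph d, ∫⁻ t, ‖f u t‖ₑ

/-- The space `L(𝕊^{d-1} × ℝ)`: functions `f(u, t)`, up to equality for almost every `t`, that are
integrable in `t` and depend continuously on `u` in `L¹(ℝ)`. Its norm is `sup_u ∫ |f(u, t)| dt`. -/
abbrev SpaceL (d : ℕ) : Type := C(Sph d, Lp ℝ 1 (volume : Measure ℝ))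

instance instMeasurableSpaceSpaceL (d : ℕ) : MeasurableSpace (SpaceL d) := borel _

instance instBorelSpaceSpaceL (d : ℕ) : BorelSpace (SpaceL d) := ⟨rfl⟩

/-- The element `g` of `L(𝕊^{d-1} × ℝ)` is (the class of) the function `f`. -/
def Represents {d : ℕ} (g : SpaceL d) (f : Sph d → ℝ → ℝ) : Prop :=
  ∀ u, ∀ᵐ t ∂(volume : Measure ℝ), g u t = f u t

/-- The processes `Y n` converge weakly in `L(𝕊^{d-1} × ℝ)` to the random element `G`. -/
def WeakConvergenceL {d : ℕ} {Ω Ω' : Type*} [MeasurableSpace Ω] [MeasurableSpace Ω']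
    (Y : ℕ → Ω → Sph d → ℝ → ℝ) (P : Measure Ω) [IsProbabilityMeasure P]
    (G : Ω' → SpaceL d) (P' : Measure Ω') [IsProbabilityMeasure P'] : Prop :=
  ∃ g : ℕ → Ω → SpaceL d, (∀ n ω, Represents (g n ω) (Y n ω)) ∧
    TendstoInDistribution g atTop G (fun _ => P) P'

/-- `D` is a derivative at `θ₀` of `θ ↦ F_{μ θ}` with respect to `‖·‖_L`:
`‖F_θ - F_{θ₀} - ⟨θ - θ₀, D⟩‖_L = o(‖θ - θ₀‖)` as `θ → θ₀` in `Θ`. -/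
def IsNormDerivative {d m : ℕ} {Θ : Set (E m)} (μ : Θ → ProbabilityMeasure (E d)) (θ₀ : Θ)
    (D : Sph d → ℝ → E m) : Prop :=
  ∀ ε : ℝ, 0 < ε → ∃ δ : ℝ, 0 < δ ∧ ∀ θ : Θ, ‖(θ : E m) - θ₀‖ < δ →
    normL (fun u t => projCDF (μ θ : Measure (E d)) u t - projCDF (μ θ₀ : Measure (E d)) u t
        - inner ℝ ((θ : E m) - θ₀) (D u t))
      ≤ ENNReal.ofReal (ε * ‖(θ : E m) - θ₀‖)

/-- `D` is nonsingular: its components are linearly independent with respect to `‖·‖_L`. -/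
def Nonsingular {d m : ℕ} (D : Sph d → ℝ → E m) : Prop :=
  ∀ h : E m, normL (fun u t => inner ℝ h (D u t)) = 0 → h = 0

/-- The model is well separated at `θ₀` in the projection robust Wasserstein distance. -/
def WellSeparated {d m : ℕ} {Θ : Set (E m)} (μ : Θ → ProbabilityMeasure (E d)) (θ₀ : Θ) : Prop :=
  ∀ ε : ℝ, 0 < ε → ∃ δ : ℝ, 0 < δ ∧
    ENNReal.ofReal δ < ⨅ (θ : Θ) (_ : ε ≤ ‖(θ : E m) - θ₀‖),
      prw 1 1 (μ θ₀ : Measure (E d)) (μ θ : Measure (E d))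

/-- The set of minimizers of `f`. -/
def argmin {α : Type*} (f : α → ℝ≥0∞) : Set α := {a | ∀ b, f a ≤ f b}

/-- The limiting criterion `θ ↦ max_u ∫ |G(u, t) - ⟨θ, D(u, t)⟩| dt` on `ℝ^m`. -/
def limitCriterion {d m : ℕ} (g : SpaceL d) (D : Sph d → ℝ → E m) (θ : E m) : ℝ≥0∞ :=
  normL (fun u t => g u t - inner ℝ θ (D u t))

end PRW

end

namespace PRW

/-! On the line, `𝒲₁` is the `L¹` distance of distribution functions
(`wasserstein_one_eq_lintegral_lineCDF`), so the projection robust distance is the `‖·‖_L` distance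
of the functions `F(u, t)` (`prw_one_one_eq`). With `g = √n (F̂_n - F_⋆)` and `a = √n`, the rescaled
distance from the empirical measure to `μ_θ` becomes `‖g - a (F_θ - F_⋆)‖_L`, and the problem turns
into a deterministic one about `g` in `L` and `a → ∞`.

Substituting `h = a (θ - θ_⋆)`, differentiability replaces this criterion by `‖g - ⟨h, D⟩‖_L`, with
an error of smaller order than `‖h‖`. Separation forces near-minimizers close to `θ_⋆`, and the
bound `c ‖h‖ ≤ ‖⟨h, D⟩‖_L` then keeps `h` bounded. Hence the two minimal values agree up to `η`,
uniformly over `‖g‖ ≤ K` (`eventually_abs_iInf_sub_le`), and rescaled minimizers are `η`-minimizers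
of the limiting criterion (`eventually_limitCriterion_le_of_mem_argmin`).

Probability enters only through tightness of `g` and the portmanteau theorem. The limiting value is
a continuous function of `g`, so the first claim follows by continuous mapping and Slutsky. For the
second, fix a closed `C`: the `g` whose limiting criterion nearly attains its infimum on `C` form a
closed set, and as the tolerance tends to `0` these sets decrease to those `g` having a minimizer in
`C`. By uniqueness this last event is almost surely that the argmin lies in `C`. -/

/-! ### Wasserstein distance on the line through distribution functions. -/

lemma lintegral_enorm_indicator_Ici_sub (x y : ℝ) :
    ∫⁻ t, ‖(Set.Ici x).indicator (1 : ℝ → ℝ) t - (Set.Ici y).indicator (1 : ℝ → ℝ) t‖ₑ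
      = ‖x - y‖ₑ := by
  wlog h : x ≤ y generalizing x y
  · have := this y x (le_of_not_ge h)
    rw [enorm_sub_rev, ← this]
    exact lintegral_congr fun t => enorm_sub_rev _ _
  have : ∀ t, ‖(Set.Ici x).indicator (1 : ℝ → ℝ) t - (Set.Ici y).indicator (1 : ℝ → ℝ) t‖ₑ
      = (Set.Ico x y).indicator (1 : ℝ → ℝ≥0∞) t := by
    intro t
    by_cases h1 : x ≤ t <;> by_cases h2 : y ≤ t <;>
      simp [Set.indicator, h1, h2] <;> grind
  simp_rw [this]
  rw [lintegral_indicator_one measurableSet_Ico, Real.volume_Ico, enorm_sub_rev,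
    Real.enorm_eq_ofReal (by linarith)]

lemma lintegral_enorm_indicator_Iic_sub (x y : ℝ) :
    ∫⁻ t, ‖(Set.Iic x).indicator (1 : ℝ → ℝ) t - (Set.Iic y).indicator (1 : ℝ → ℝ) t‖ₑ
      = ‖x - y‖ₑ := by
  wlog h : x ≤ y generalizing x y
  · have := this y x (le_of_not_ge h)
    rw [enorm_sub_rev, ← this]
    exact lintegral_congr fun t => enorm_sub_rev _ _
  have : ∀ t, ‖(Set.Iic x).indicator (1 : ℝ → ℝ) t - (Set.Iic y).indicator (1 : ℝ → ℝ) t‖ₑ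
      = (Set.Ioc x y).indicator (1 : ℝ → ℝ≥0∞) t := by
    intro t
    by_cases h1 : t ≤ x <;> by_cases h2 : t ≤ y <;>
      simp [Set.indicator, h1, h2] <;> grind
  simp_rw [this]
  rw [lintegral_indicator_one measurableSet_Ioc, Real.volume_Ioc, enorm_sub_rev,
    Real.enorm_eq_ofReal (by linarith)]

lemma edist_eq_enorm_coord_sub (x y : E 1) : edist x y = ‖x 0 - y 0‖ₑ := by
  rw [edist_eq_enorm_sub, ← ofReal_norm, ← ofReal_norm, EuclideanSpace.norm_eq]
  simp [Real.sqrt_sq_eq_abs]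

lemma wasserstein_one_eq {α : Type*} [MeasurableSpace α] [PseudoEMetricSpace α] (μ ν : Measure α) :
    wasserstein 1 μ ν = ⨅ (π : Measure (α × α)) (_ : IsCoupling μ ν π), ∫⁻ z, edist z.1 z.2 ∂π := by
  simp [wasserstein]

/-- The distribution function of a measure on the line. -/
noncomputable def lineCDF (μ : Measure (E 1)) (t : ℝ) : ℝ := μ.real {x | x 0 ≤ t}

lemma measurable_coord : Measurable (fun x : E 1 => x 0) := by fun_prop

/-- Under a coupling, the difference of the distribution functions at `t` is the mean of a
difference of indicators. Take absolute values inside, then integrate over `t` first by Tonelli. -/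
lemma lintegral_lineCDF_le_of_isCoupling (μ ν : Measure (E 1)) [IsProbabilityMeasure μ]
    (π : Measure (E 1 × E 1)) (h : IsCoupling μ ν π) :
    ∫⁻ t, ‖lineCDF μ t - lineCDF ν t‖ₑ ≤ ∫⁻ z, edist z.1 z.2 ∂π := by
  have hπ : IsProbabilityMeasure π := by
    constructor
    rw [← measure_univ (μ := μ), ← h.1, Measure.map_apply measurable_fst MeasurableSet.univ,
      Set.preimage_univ]
  have h1 : ∀ t, ‖lineCDF μ t - lineCDF ν t‖ₑ ≤
      ∫⁻ z, ‖(Set.Ici (z.1 0)).indicator (1 : ℝ → ℝ) t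
        - (Set.Ici (z.2 0)).indicator (1 : ℝ → ℝ) t‖ₑ ∂π := by
    intro t
    have hm : MeasurableSet {x : E 1 | x 0 ≤ t} := measurable_coord measurableSet_Iic
    have e1 : lineCDF μ t = ∫ z, (Set.Ici (z.1 0)).indicator (1 : ℝ → ℝ) t ∂π := by
      rw [lineCDF, ← h.1, map_measureReal_apply measurable_fst hm,
        ← integral_indicator_one (measurable_fst hm)]
      rfl
    have e2 : lineCDF ν t = ∫ z, (Set.Ici (z.2 0)).indicator (1 : ℝ → ℝ) t ∂π := by
      rw [lineCDF, ← h.2, map_measureReal_apply measurable_snd hm,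
        ← integral_indicator_one (measurable_snd hm)]
      rfl
    have i1 : Integrable (fun z : E 1 × E 1 => (Set.Ici (z.1 0)).indicator (1 : ℝ → ℝ) t) π :=
      (integrable_const (1 : ℝ)).indicator (measurable_fst hm)
    have i2 : Integrable (fun z : E 1 × E 1 => (Set.Ici (z.2 0)).indicator (1 : ℝ → ℝ) t) π :=
      (integrable_const (1 : ℝ)).indicator (measurable_snd hm)
    rw [e1, e2, ← integral_sub i1 i2]
    exact enorm_integral_le_lintegral_enorm _
  refine (lintegral_mono h1).trans ?_
  have hmeas : Measurable (fun p : ℝ × (E 1 × E 1) => ‖(Set.Ici (p.2.1 0)).indicator (1 : ℝ → ℝ) p.1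
        - (Set.Ici (p.2.2 0)).indicator (1 : ℝ → ℝ) p.1‖ₑ) := by
    refine Measurable.enorm (Measurable.sub ?_ ?_)
    · exact (measurable_const (a := (1 : ℝ))).indicator
        (s := {p : ℝ × (E 1 × E 1) | p.2.1 0 ≤ p.1})
        (measurableSet_le (by fun_prop) (by fun_prop))
    · exact (measurable_const (a := (1 : ℝ))).indicator
        (s := {p : ℝ × (E 1 × E 1) | p.2.2 0 ≤ p.1})
        (measurableSet_le (by fun_prop) (by fun_prop))
  rw [lintegral_lintegral_swap hmeas.aemeasurable]
  simp_rw [lintegral_enorm_indicator_Ici_sub, edist_eq_enorm_coord_sub]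
  exact le_rfl

/-- The quantile function of a measure on the line. -/
noncomputable def quantile (ρ : Measure ℝ) (s : ℝ) : ℝ := sInf {t | s ≤ cdf ρ t}

/-- Right-continuity of the distribution function makes the infimum attained. The restriction to `0
< s < 1` makes the set nonempty and bounded below. -/
lemma quantile_le_iff (ρ : Measure ℝ) {s : ℝ} (hs : s ∈ Set.Ioo (0 : ℝ) 1)
    (t : ℝ) : quantile ρ s ≤ t ↔ s ≤ cdf ρ t := by
  have hne : {t | s ≤ cdf ρ t}.Nonempty :=
    (((tendsto_cdf_atTop ρ).eventually (lt_mem_nhds hs.2)).exists).imp fun _ h => le_of_lt h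
  have hbdd : BddBelow {t | s ≤ cdf ρ t} := by
    obtain ⟨a, ha⟩ := ((tendsto_cdf_atBot ρ).eventually (gt_mem_nhds hs.1)).exists
    refine ⟨a, fun t ht => ?_⟩
    by_contra hlt
    exact absurd (ht.trans (monotone_cdf ρ (le_of_not_ge hlt))) (not_le.2 ha)
  refine ⟨fun h => ?_, fun h => csInf_le hbdd h⟩
  have hright : ∀ x, t < x → s ≤ cdf ρ x := by
    intro x hx
    obtain ⟨y, hy, hyx⟩ := exists_lt_of_csInf_lt hne (lt_of_le_of_lt h hx)
    exact le_trans hy (monotone_cdf ρ hyx.le)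
  have hc : Tendsto (cdf ρ) (𝓝[>] t) (𝓝 (cdf ρ t)) :=
    ((cdf ρ).right_continuous t).mono_left (nhdsWithin_mono _ Set.Ioi_subset_Ici_self)
  exact ge_of_tendsto hc (eventually_nhdsWithin_of_forall hright)

lemma aemeasurable_quantile (ρ : Measure ℝ) :
    AEMeasurable (quantile ρ) (volume.restrict (Set.Ioo (0 : ℝ) 1)) := by
  refine aemeasurable_restrict_of_monotoneOn measurableSet_Ioo fun s hs s' hs' hss => ?_
  rw [quantile_le_iff ρ hs]
  exact hss.trans ((quantile_le_iff ρ hs' _).1 le_rfl)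

instance : IsProbabilityMeasure ((volume : Measure ℝ).restrict (Set.Ioo (0 : ℝ) 1)) :=
  ⟨by simp⟩

lemma map_quantile (ρ : Measure ℝ) [IsProbabilityMeasure ρ] :
    (volume.restrict (Set.Ioo (0 : ℝ) 1)).map (quantile ρ) = ρ := by
  have : IsProbabilityMeasure ((volume.restrict (Set.Ioo (0 : ℝ) 1)).map (quantile ρ)) :=
    Measure.isProbabilityMeasure_map (aemeasurable_quantile ρ)
  refine Measure.ext_of_Iic _ _ fun t => ?_
  rw [Measure.map_apply_of_aemeasurable (aemeasurable_quantile ρ) measurableSet_Iic,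
    Measure.restrict_apply' measurableSet_Ioo, ← ofReal_cdf]
  have : quantile ρ ⁻¹' Set.Iic t ∩ Set.Ioo 0 1 = Set.Ioo 0 1 ∩ Set.Iic (cdf ρ t) := by
    ext s
    constructor
    · rintro ⟨h1, h2⟩; exact ⟨h2, (quantile_le_iff ρ h2 t).1 h1⟩
    · rintro ⟨h1, h2⟩; exact ⟨(quantile_le_iff ρ h1 t).2 h2, h1⟩
  rw [this]
  refine le_antisymm ?_ ?_
  · refine (measure_mono (t := Set.Ioc 0 (cdf ρ t)) fun s hs => ⟨hs.1.1, hs.2⟩).trans ?_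
    rw [Real.volume_Ioc, sub_zero]
  · refine le_trans ?_ (measure_mono (s := Set.Ioo 0 (cdf ρ t)) fun s hs =>
      ⟨⟨hs.1, hs.2.trans_le (cdf_le_one ρ t)⟩, hs.2.le⟩)
    rw [Real.volume_Ioo, sub_zero]

/-- Both sides measure the area between the two graphs, sliced in the two directions;
`quantile_le_iff` identifies the slices. Enlarging `(0, 1)` to the line gives the inequality, which
is all that is needed. -/
lemma lintegral_quantile_sub_le (ρ σ : Measure ℝ) :
    ∫⁻ s in Set.Ioo (0 : ℝ) 1, ‖quantile ρ s - quantile σ s‖ₑ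
      ≤ ∫⁻ t, ‖cdf ρ t - cdf σ t‖ₑ := by
  have h1 : ∀ s ∈ Set.Ioo (0 : ℝ) 1, ‖quantile ρ s - quantile σ s‖ₑ =
      ∫⁻ t, ‖(Set.Iic (cdf ρ t)).indicator (1 : ℝ → ℝ) s
        - (Set.Iic (cdf σ t)).indicator (1 : ℝ → ℝ) s‖ₑ := by
    intro s hs
    rw [← lintegral_enorm_indicator_Ici_sub]
    refine lintegral_congr fun t => ?_
    simp only [Set.indicator, Set.mem_Ici, Set.mem_Iic, quantile_le_iff _ hs, Pi.one_apply]
  rw [setLIntegral_congr_fun measurableSet_Ioo h1]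
  have hmeas : Measurable (fun p : ℝ × ℝ => ‖(Set.Iic (cdf ρ p.2)).indicator (1 : ℝ → ℝ) p.1
        - (Set.Iic (cdf σ p.2)).indicator (1 : ℝ → ℝ) p.1‖ₑ) := by
    have hc : ∀ ρ : Measure ℝ, Measurable fun p : ℝ × ℝ => cdf ρ p.2 := fun ρ =>
      (monotone_cdf ρ).measurable.comp measurable_snd
    refine Measurable.enorm (Measurable.sub ?_ ?_)
    · exact (measurable_const (a := (1 : ℝ))).indicator
        (s := {p : ℝ × ℝ | p.1 ≤ cdf ρ p.2}) (measurableSet_le measurable_fst (hc ρ))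
    · exact (measurable_const (a := (1 : ℝ))).indicator
        (s := {p : ℝ × ℝ | p.1 ≤ cdf σ p.2}) (measurableSet_le measurable_fst (hc σ))
  rw [lintegral_lintegral_swap hmeas.aemeasurable]
  refine lintegral_mono fun t => ?_
  rw [← lintegral_enorm_indicator_Iic_sub]
  exact lintegral_mono' Measure.restrict_le_self le_rfl

lemma measurable_toLp_const : Measurable (fun r : ℝ => (WithLp.toLp 2 (fun _ => r) : E 1)) := by
  fun_prop

lemma map_quantile_coord (μ : Measure (E 1)) [IsProbabilityMeasure μ] :
    (volume.restrict (Set.Ioo (0 : ℝ) 1)).map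
      (fun s => (WithLp.toLp 2 (fun _ => quantile (μ.map (fun x => x 0)) s) : E 1)) = μ := by
  have : IsProbabilityMeasure (μ.map (fun x => x 0)) :=
    Measure.isProbabilityMeasure_map measurable_coord.aemeasurable
  have h := AEMeasurable.map_map_of_aemeasurable
    measurable_toLp_const.aemeasurable (aemeasurable_quantile (μ.map (fun x => x 0)))
  rw [map_quantile, Measure.map_map measurable_toLp_const measurable_coord] at h
  refine h.symm.trans ?_
  convert Measure.map_id
  ext x i
  simp [Subsingleton.elim i 0]

lemma cdf_map_coord (μ : Measure (E 1)) [IsProbabilityMeasure μ] (t : ℝ) :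
    cdf (μ.map (fun x => x 0)) t = lineCDF μ t := by
  have : IsProbabilityMeasure (μ.map (fun x => x 0)) :=
    Measure.isProbabilityMeasure_map measurable_coord.aemeasurable
  rw [cdf_eq_real, map_measureReal_apply measurable_coord measurableSet_Iic]
  rfl

/-- On the line the Wasserstein distance of order `1` is the `L¹` distance of the distribution
functions. -/
theorem wasserstein_one_eq_lintegral_lineCDF (μ ν : Measure (E 1)) [IsProbabilityMeasure μ]
    [IsProbabilityMeasure ν] :
    wasserstein 1 μ ν = ∫⁻ t, ‖lineCDF μ t - lineCDF ν t‖ₑ := by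
  rw [wasserstein_one_eq]
  refine le_antisymm ?_ (le_iInf₂ fun π hπ => lintegral_lineCDF_le_of_isCoupling μ ν π hπ)
  let q : Measure (E 1) → ℝ → E 1 := fun μ s =>
    WithLp.toLp 2 (fun _ => quantile (μ.map (fun x => x 0)) s)
  have hq : ∀ μ, AEMeasurable (q μ) (volume.restrict (Set.Ioo (0 : ℝ) 1)) := fun μ =>
    measurable_toLp_const.comp_aemeasurable (aemeasurable_quantile _)
  have hp := (hq μ).prodMk (hq ν)
  -- The optimal coupling is the monotone one: both quantile functions are evaluated at the same
  -- uniform variable.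
  refine (iInf₂_le ((volume.restrict (Set.Ioo (0 : ℝ) 1)).map (fun s => (q μ s, q ν s)))
    ?_).trans ?_
  · refine ⟨?_, ?_⟩
    · rw [AEMeasurable.map_map_of_aemeasurable measurable_fst.aemeasurable hp]
      exact map_quantile_coord μ
    · rw [AEMeasurable.map_map_of_aemeasurable measurable_snd.aemeasurable hp]
      exact map_quantile_coord ν
  · rw [lintegral_map' measurable_edist.aemeasurable hp]
    simp only [edist_eq_enorm_coord_sub, q]
    refine (lintegral_quantile_sub_le _ _).trans ?_
    simp_rw [cdf_map_coord]
    exact le_rfl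

/-! ### One-dimensional projections and empirical measures. -/

lemma measurable_proj {d k : ℕ} (A : Matrix (Fin d) (Fin k) ℝ) : Measurable (proj A) := by
  unfold proj
  fun_prop

lemma lineCDF_map_proj {d : ℕ} (μ : Measure (E d)) (A : Matrix (Fin d) (Fin 1) ℝ) (u : Sph d)
    (h : ∀ i, (u : E d) i = A i 0) (t : ℝ) :
    lineCDF (μ.map (proj A)) t = projCDF μ u t := by
  rw [lineCDF, map_measureReal_apply (measurable_proj A) (measurableSet_le measurable_coord measurable_const),
    projCDF]
  congr 1
  ext x
  simp [proj, Matrix.mulVec, dotProduct, PiLp.inner_apply, h, mul_comm]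

/-- The projection robust Wasserstein distance of order `1` and dimension `1` is the `normL`
distance of the distribution functions of the projections. -/
theorem prw_one_one_eq {d : ℕ} (μ ν : Measure (E d)) [IsProbabilityMeasure μ]
    [IsProbabilityMeasure ν] :
    prw 1 1 μ ν = normL (fun u t => projCDF μ u t - projCDF ν u t) := by
  have key : ∀ (A : Matrix (Fin d) (Fin 1) ℝ) (u : Sph d), (∀ i, (u : E d) i = A i 0) →
      wasserstein 1 (μ.map (proj A)) (ν.map (proj A))
        = ∫⁻ t, ‖projCDF μ u t - projCDF ν u t‖ₑ := by
    intro A u h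
    have := Measure.isProbabilityMeasure_map (μ := μ) (measurable_proj A).aemeasurable
    have := Measure.isProbabilityMeasure_map (μ := ν) (measurable_proj A).aemeasurable
    simp_rw [wasserstein_one_eq_lintegral_lineCDF, lineCDF_map_proj _ A u h]
  -- One-column matrices with orthonormal columns are exactly the unit vectors, so both suprema run
  -- over the sphere.
  have hsum : ∀ (A : Matrix (Fin d) (Fin 1) ℝ), A.transpose * A = 1 ↔ ∑ i, A i 0 ^ 2 = 1 := by
    intro A
    rw [← Matrix.ext_iff]
    simp [Matrix.mul_apply, pow_two]
  refine le_antisymm (iSup₂_le fun A hA => ?_) (iSup_le fun u => ?_)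
  · have hu : (WithLp.toLp 2 (fun i => A i 0) : E d) ∈ Metric.sphere (0 : E d) 1 := by
      rw [mem_sphere_zero_iff_norm, EuclideanSpace.norm_eq]
      simp [(hsum A).1 hA]
    rw [key A ⟨_, hu⟩ fun _ => rfl]
    exact le_iSup (fun u : Sph d => ∫⁻ t, ‖projCDF μ u t - projCDF ν u t‖ₑ) ⟨_, hu⟩
  · rw [← key (Matrix.of fun i _ => (u : E d) i) u fun _ => rfl]
    refine le_iSup₂_of_le (Matrix.of fun i _ => (u : E d) i) ?_ le_rfl
    rw [hsum]
    have := mem_sphere_zero_iff_norm.1 u.2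
    rw [EuclideanSpace.norm_eq, Real.sqrt_eq_one] at this
    simpa using this

instance isProbabilityMeasure_empirical {d : ℕ} (n : ℕ) [NeZero n] (x : ℕ → E d) :
    IsProbabilityMeasure (empirical n x) := by
  constructor
  simp [empirical, ENNReal.inv_mul_cancel (Nat.cast_ne_zero.2 (NeZero.ne n))
    (ENNReal.natCast_ne_top n)]

lemma measurableSet_halfSpace {d : ℕ} (u : E d) (t : ℝ) :
    MeasurableSet {x : E d | inner ℝ u x ≤ t} :=
  measurableSet_le (by fun_prop) measurable_const

lemma projCDF_empirical {d : ℕ} (n : ℕ) (x : ℕ → E d) (u : Sph d) (t : ℝ) :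
    projCDF (empirical n x) u t = empCDF n x u t := by
  rw [projCDF, measureReal_def, empirical, empCDF, Measure.smul_apply, Measure.finsetSum_apply]
  simp only [Measure.dirac_apply' _ (measurableSet_halfSpace (u : E d) t), smul_eq_mul,
    ENNReal.toReal_mul, ENNReal.toReal_inv, ENNReal.toReal_natCast]
  congr 1
  simp [Set.indicator]

lemma monotone_projCDF {d : ℕ} (μ : Measure (E d)) [IsFiniteMeasure μ] (u : Sph d) :
    Monotone (projCDF μ u) := fun _ _ h =>
  measureReal_mono fun _ hx => le_trans hx h

/-! ### The extended seminorm `‖·‖_L` and distances to families of functions. -/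

section NormL

variable {d : ℕ}

lemma normL_add_le {f g : Sph d → ℝ → ℝ} (hf : ∀ u, AEMeasurable (f u)) :
    normL (fun u t => f u t + g u t) ≤ normL f + normL g := by
  refine iSup_le fun u => ?_
  calc ∫⁻ t, ‖f u t + g u t‖ₑ ≤ ∫⁻ t, (‖f u t‖ₑ + ‖g u t‖ₑ) :=
        lintegral_mono fun t => enorm_add_le _ _
    _ = (∫⁻ t, ‖f u t‖ₑ) + ∫⁻ t, ‖g u t‖ₑ := lintegral_add_left' (hf u).enorm _
    _ ≤ normL f + normL g := add_le_add (le_iSup (fun u => ∫⁻ t, ‖f u t‖ₑ) u)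
        (le_iSup (fun u => ∫⁻ t, ‖g u t‖ₑ) u)

lemma normL_mono {f g : Sph d → ℝ → ℝ} (h : ∀ u, ∀ᵐ t, ‖f u t‖ₑ ≤ ‖g u t‖ₑ) :
    normL f ≤ normL g :=
  iSup_mono fun u => lintegral_mono_ae (h u)

lemma normL_congr {f g : Sph d → ℝ → ℝ} (h : ∀ u, ∀ᵐ t, f u t = g u t) : normL f = normL g :=
  le_antisymm (normL_mono fun u => (h u).mono fun t ht => by rw [ht])
    (normL_mono fun u => (h u).mono fun t ht => by rw [ht])

lemma normL_sub_comm (f g : Sph d → ℝ → ℝ) :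
    normL (fun u t => f u t - g u t) = normL (fun u t => g u t - f u t) := by
  simp only [normL, enorm_sub_rev]

lemma normL_const_mul (c : ℝ) (f : Sph d → ℝ → ℝ) :
    normL (fun u t => c * f u t) = ‖c‖ₑ * normL f := by
  simp only [normL, enorm_mul, lintegral_const_mul' _ _ enorm_ne_top, ENNReal.mul_iSup]

/-- The triangle inequality for `normL`, for three functions. -/
lemma normL_sub_le {f g h : Sph d → ℝ → ℝ} (hf : ∀ u, AEMeasurable (f u))
    (hg : ∀ u, AEMeasurable (g u)) :
    normL (fun u t => f u t - h u t) ≤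
      normL (fun u t => f u t - g u t) + normL (fun u t => g u t - h u t) := by
  refine le_trans (le_of_eq ?_) (normL_add_le fun u => (hf u).sub (hg u))
  simp

lemma aemeasurable_coe (g : SpaceL d) (u : Sph d) : AEMeasurable (fun t => g u t) :=
  (Lp.aestronglyMeasurable (g u)).aemeasurable

lemma normL_coe_sub_le (g g' : SpaceL d) :
    normL (fun u t => g u t - g' u t) ≤ ‖g - g'‖ₑ := by
  refine iSup_le fun u => ?_
  have h1 : ∫⁻ t, ‖g u t - g' u t‖ₑ = ‖(g - g') u‖ₑ := by
    rw [Lp.enorm_def, eLpNorm_one_eq_lintegral_enorm]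
    refine lintegral_congr_ae ?_
    filter_upwards [Lp.coeFn_sub (g u) (g' u)] with t ht
    rw [ContinuousMap.sub_apply, ht, Pi.sub_apply]
  rw [h1, ← ofReal_norm, ← ofReal_norm]
  exact ENNReal.ofReal_le_ofReal ((g - g').norm_coe_le_norm u)

lemma normL_coe_le (g : SpaceL d) : normL (fun u t => g u t) ≤ ‖g‖ₑ := by
  refine le_trans (le_of_eq (normL_congr fun u => ?_)) ((normL_coe_sub_le g 0).trans (by simp))
  filter_upwards [Lp.coeFn_zero (E := ℝ) (p := 1) (μ := (volume : Measure ℝ))] with t ht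
  simp

lemma normL_coe_lt_top (g : SpaceL d) : normL (fun u t => g u t) < ∞ :=
  (normL_coe_le g).trans_lt enorm_lt_top

/-- The smallest distance of `g` from the functions `f i`. -/
noncomputable def infDistL {ι : Sort*} (f : ι → Sph d → ℝ → ℝ) (g : SpaceL d) : ℝ≥0∞ :=
  ⨅ i, normL (fun u t => g u t - f i u t)

variable {ι : Sort*} {f : ι → Sph d → ℝ → ℝ}

/-- An infimum of 1-Lipschitz functions is 1-Lipschitz. No regularity of the family is required, so
this covers both the rescaled and the limiting problem, on any parameter set. -/
lemma continuous_infDistL (f : ι → Sph d → ℝ → ℝ) : Continuous (infDistL f) := by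
  refine continuous_of_le_add_edist 1 ENNReal.one_ne_top fun g g' => ?_
  rw [one_mul, infDistL, infDistL, ENNReal.iInf_add]
  refine iInf_mono fun i => ?_
  rw [add_comm, edist_eq_enorm_sub]
  exact (normL_sub_le (aemeasurable_coe g) (aemeasurable_coe g')).trans
    (add_le_add (normL_coe_sub_le g g') le_rfl)

lemma infDistL_lt_top (g : SpaceL d) (i : ι) (hi : normL (f i) < ∞) : infDistL f g < ∞ := by
  refine (iInf_le _ i).trans_lt ?_
  have := normL_add_le (g := fun u t => - f i u t) (aemeasurable_coe g)
  simp only [← sub_eq_add_neg] at this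
  refine this.trans_lt (ENNReal.add_lt_top.2 ⟨normL_coe_lt_top g, ?_⟩)
  simpa [normL] using hi

lemma continuous_toReal_infDistL (i : ι) (hi : normL (f i) < ∞) :
    Continuous fun g => (infDistL f g).toReal :=
  ENNReal.continuousOn_toReal.comp_continuous (continuous_infDistL f)
    fun g => (infDistL_lt_top g i hi).ne

end NormL

/-! ### Two-sided bounds for the norm derivative. -/

section Derivative

variable {d m : ℕ} {Θ : Set (E m)} {μ : Θ → ProbabilityMeasure (E d)} {θs : Θ}
  {D : Sph d → ℝ → E m}

lemma normL_inner_smul (D : Sph d → ℝ → E m) (c : ℝ) (h : E m) :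
    normL (fun u t => inner ℝ (c • h) (D u t)) = ‖c‖ₑ * normL (fun u t => inner ℝ h (D u t)) := by
  simp only [real_inner_smul_left, normL_const_mul]

lemma measurable_inner_apply (hDm : ∀ u, Measurable (D u)) (h : E m) (u : Sph d) :
    Measurable fun t => inner ℝ h (D u t) := by
  have := hDm u
  fun_prop

lemma measurable_projCDF (ν : Measure (E d)) [IsFiniteMeasure ν] (u : Sph d) :
    Measurable (projCDF ν u) := (monotone_projCDF ν u).measurable

lemma projCDF_mem_Icc (ν : Measure (E d)) [IsProbabilityMeasure ν] (u : Sph d) (t : ℝ) :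
    projCDF ν u t ∈ Set.Icc (0 : ℝ) 1 :=
  ⟨measureReal_nonneg, measureReal_le_one⟩

/-- The norm derivative has finite norm: it is dominated through the one-sided bounds that
`0 ≤ F_θ ≤ 1` imposes on the increments in two opposite directions. -/
lemma exists_normL_inner_le (hint : (θs : E m) ∈ interior Θ) (hDm : ∀ u, Measurable (D u))
    (hD : IsNormDerivative μ θs D) (F₁ : Sph d → ℝ → ℝ) (h01 : ∀ u t, F₁ u t = 0 ∨ F₁ u t = 1)
    (hF₁m : ∀ u, AEMeasurable (F₁ u))
    (hF₁ : normL (fun u t => F₁ u t - projCDF (μ θs : Measure (E d)) u t) < ∞) :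
    ∃ C : ℝ, 0 ≤ C ∧ ∀ h : E m, normL (fun u t => inner ℝ h (D u t)) ≤ ENNReal.ofReal (C * ‖h‖) := by
  obtain ⟨δ, hδ, hδD⟩ := hD 1 one_pos
  obtain ⟨r, hr, hrΘ⟩ := Metric.isOpen_iff.1 isOpen_interior _ hint
  set s := min δ r / 2 with hs
  have hs0 : 0 < s := by positivity
  have hsδ : s < δ := by have := min_le_left δ r; grind
  have hsr : s < r := by have := min_le_right δ r; grind
  set W := normL (fun u t => F₁ u t - projCDF (μ θs : Measure (E d)) u t) with hW
  have hB : ∀ h : E m, ‖h‖ = s → normL (fun u t => inner ℝ h (D u t)) ≤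
      ENNReal.ofReal (W.toReal + s + s) := by
    intro h hh
    have hmem : ∀ k : E m, ‖k‖ = s → (θs : E m) + k ∈ Θ := fun k hk =>
      interior_subset (hrΘ (by simpa [hk] using hsr))
    let R : E m → Sph d → ℝ → ℝ := fun k u t =>
      (if hk : ‖k‖ = s then projCDF (μ ⟨_, hmem k hk⟩ : Measure (E d)) u t else 0)
        - projCDF (μ θs : Measure (E d)) u t - inner ℝ k (D u t)
    have hRm : ∀ k u, AEMeasurable (R k u) := by
      intro k u
      refine AEMeasurable.sub (AEMeasurable.sub ?_ (measurable_projCDF _ u).aemeasurable)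
        (measurable_inner_apply hDm k u).aemeasurable
      split_ifs
      · exact (measurable_projCDF _ u).aemeasurable
      · exact aemeasurable_const
    have hR : ∀ k, ‖k‖ = s → normL (R k) ≤ ENNReal.ofReal s := by
      intro k hk
      have := hδD ⟨_, hmem k hk⟩ (by simpa [hk] using hsδ)
      simpa [R, hk] using this
    have h' : ‖-h‖ = s := by rwa [norm_neg]
    -- Where `F₁ = 0`, increments of `F` are at least `-F_⋆ = -|F₁ - F_⋆|`; where `F₁ = 1`, they are
    -- at most `1 - F_⋆ = |F₁ - F_⋆|`. Using the same one-sided bound for `h` and `-h` bounds `⟨h,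
    -- D⟩` from both sides.
    have key : normL (fun u t => inner ℝ h (D u t)) ≤ normL (fun u t =>
        (|F₁ u t - projCDF (μ θs : Measure (E d)) u t| + |R h u t|) + |R (-h) u t|) := by
      refine normL_mono fun u => Eventually.of_forall fun t => ?_
      rw [Real.enorm_eq_ofReal_abs, Real.enorm_eq_ofReal_abs]
      refine ENNReal.ofReal_le_ofReal ?_
      rw [abs_of_nonneg (by positivity : 0 ≤ |F₁ u t - projCDF (μ θs : Measure (E d)) u t|
        + |R h u t| + |R (-h) u t|)]
      have a1 := projCDF_mem_Icc (μ θs : Measure (E d)) u t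
      have a2 := projCDF_mem_Icc (μ ⟨_, hmem h hh⟩ : Measure (E d)) u t
      have a3 := projCDF_mem_Icc (μ ⟨_, hmem (-h) h'⟩ : Measure (E d)) u t
      have r1 : R h u t = projCDF (μ ⟨_, hmem h hh⟩ : Measure (E d)) u t
          - projCDF (μ θs : Measure (E d)) u t - inner ℝ h (D u t) := by simp only [R, dif_pos hh]
      have r2 : R (-h) u t = projCDF (μ ⟨_, hmem (-h) h'⟩ : Measure (E d)) u t
          - projCDF (μ θs : Measure (E d)) u t + inner ℝ h (D u t) := by
        simp only [R, dif_pos h', inner_neg_left]; ring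
      generalize R h u t = x1 at *
      generalize R (-h) u t = x2 at *
      generalize projCDF (μ θs : Measure (E d)) u t = y1 at *
      generalize projCDF (μ ⟨_, hmem h hh⟩ : Measure (E d)) u t = y2 at *
      generalize projCDF (μ ⟨_, hmem (-h) h'⟩ : Measure (E d)) u t = y3 at *
      have b1 := neg_abs_le x1
      have b2 := le_abs_self x1
      have b3 := neg_abs_le x2
      have b4 := le_abs_self x2
      have b5 := abs_nonneg x1
      have b6 := abs_nonneg x2
      obtain ⟨a11, a12⟩ := a1
      obtain ⟨a21, a22⟩ := a2
      obtain ⟨a31, a32⟩ := a3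
      rcases h01 u t with h0 | h0 <;> rw [h0, abs_le]
      · rw [zero_sub, abs_neg, abs_of_nonneg a11]; constructor <;> linarith
      · rw [abs_of_nonneg (by linarith : 0 ≤ 1 - y1)]; constructor <;> linarith
    have habs : ∀ f : Sph d → ℝ → ℝ, normL (fun u t => |f u t|) = normL f := fun f => by
      simp [normL]
    have hFm : ∀ u, AEMeasurable (fun t => |F₁ u t - projCDF (μ θs : Measure (E d)) u t|) :=
      fun u => ((hF₁m u).sub (measurable_projCDF _ u).aemeasurable).abs
    refine key.trans ((normL_add_le fun u => (hFm u).add (hRm h u).abs).trans ?_)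
    refine (add_le_add (normL_add_le hFm) le_rfl).trans ?_
    rw [habs, habs, habs, ENNReal.ofReal_add (by positivity) hs0.le,
      ENNReal.ofReal_add (by positivity) hs0.le, ENNReal.ofReal_toReal hF₁.ne]
    gcongr
    · exact hR h hh
    · exact hR _ h'
  refine ⟨(W.toReal + s + s) / s, by positivity, fun h => ?_⟩
  rcases eq_or_ne h 0 with rfl | h0
  · simp [normL]
  have hn : 0 < ‖h‖ := norm_pos_iff.2 h0
  have e : h = (‖h‖ / s) • ((s / ‖h‖) • h) := by
    rw [smul_smul]; field_simp; simp
  rw [e, normL_inner_smul, ← e, Real.enorm_eq_ofReal (by positivity)]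
  refine (mul_le_mul_right (hB _ ?_) _).trans (le_of_eq ?_)
  · rw [norm_smul, Real.norm_of_nonneg (by positivity)]; field_simp
  · rw [← ENNReal.ofReal_mul (by positivity)]
    congr 1; ring

/-- Continuity of the limiting criterion in the parameter. -/
lemma continuous_limitCriterion (hDm : ∀ u, Measurable (D u)) {C : ℝ} (hC0 : 0 ≤ C)
    (hC : ∀ h : E m, normL (fun u t => inner ℝ h (D u t)) ≤ ENNReal.ofReal (C * ‖h‖))
    (g : SpaceL d) : Continuous (limitCriterion g D) := by
  refine continuous_of_le_add_edist (ENNReal.ofReal C) ENNReal.ofReal_ne_top fun x y => ?_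
  have h1 := normL_sub_le (f := fun u t => g u t - inner ℝ x (D u t))
    (g := fun u t => g u t - inner ℝ y (D u t)) (h := fun _ _ => 0)
    (fun u => (aemeasurable_coe g u).sub (measurable_inner_apply hDm x u).aemeasurable)
    (fun u => (aemeasurable_coe g u).sub (measurable_inner_apply hDm y u).aemeasurable)
  simp only [sub_zero, sub_sub_sub_cancel_left, ← inner_sub_left] at h1
  refine h1.trans ?_
  rw [add_comm]
  refine add_le_add le_rfl ((hC _).trans ?_)
  rw [ENNReal.ofReal_mul hC0, ← dist_eq_norm, ← edist_dist, edist_comm]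

/-- A nonsingular derivative of finite norm is bounded below. -/
lemma exists_le_normL_inner (hDm : ∀ u, Measurable (D u)) {C : ℝ} (hC0 : 0 ≤ C)
    (hC : ∀ h : E m, normL (fun u t => inner ℝ h (D u t)) ≤ ENNReal.ofReal (C * ‖h‖))
    (hDns : Nonsingular D) :
    ∃ c : ℝ, 0 < c ∧ ∀ h : E m,
      ENNReal.ofReal (c * ‖h‖) ≤ normL (fun u t => inner ℝ h (D u t)) := by
  have hcont : Continuous fun h : E m => normL (fun u t => inner ℝ h (D u t)) := by
    have h0 := continuous_limitCriterion hDm hC0 hC 0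
    convert h0 using 2 with h
    rw [limitCriterion]
    refine Eq.trans (by simp [normL]) (normL_congr (f := fun u t => 0 - inner ℝ h (D u t)) fun u => ?_)
    filter_upwards [Lp.coeFn_zero (E := ℝ) (p := 1) (μ := (volume : Measure ℝ))] with t ht
    simp
  have hc : ∃ c : ℝ, 0 < c ∧ ∀ h : E m, ‖h‖ = 1 →
      ENNReal.ofReal c ≤ normL (fun u t => inner ℝ h (D u t)) := by
    -- The sphere is empty when `m = 0`, and then any constant works.
    rcases (Metric.sphere (0 : E m) 1).eq_empty_or_nonempty with he | hne
    · refine ⟨1, one_pos, fun h hh => ?_⟩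
      have : h ∈ Metric.sphere (0 : E m) 1 := by simpa using hh
      simp [he] at this
    · obtain ⟨h₀, hh₀, hmin⟩ := (isCompact_sphere (0 : E m) 1).exists_isMinOn hne hcont.continuousOn
      have hfin : normL (fun u t => inner ℝ h₀ (D u t)) ≠ ∞ :=
        ((hC h₀).trans_lt ENNReal.ofReal_lt_top).ne
      refine ⟨_, ENNReal.toReal_pos (fun h => ?_) hfin, fun h hh => ?_⟩
      · have := hDns _ h
        simp [this] at hh₀
      · rw [ENNReal.ofReal_toReal hfin]
        exact hmin (by simpa using hh)
  obtain ⟨c, hc0, hc⟩ := hc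
  refine ⟨c, hc0, fun h => ?_⟩
  rcases eq_or_ne h 0 with rfl | h0
  · simp
  have hn : 0 < ‖h‖ := norm_pos_iff.2 h0
  have e : h = ‖h‖ • (‖h‖⁻¹ • h) := by
    rw [smul_smul]; field_simp; simp
  rw [e, normL_inner_smul, ← e, mul_comm c, ENNReal.ofReal_mul hn.le,
    Real.enorm_eq_ofReal hn.le]
  refine mul_le_mul_right (hc _ ?_) _
  rw [norm_smul, norm_inv, norm_norm]; field_simp

end Derivative

/-! ### Deterministic comparison of the rescaled and limiting problems. -/

section LocalAsymptotics

variable {d m : ℕ} {Θ : Set (E m)} {μ : Θ → ProbabilityMeasure (E d)} {θs : Θ}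
  {D : Sph d → ℝ → E m}

/-- The increment `F_θ - F_{θ₀}` of the projected distribution functions. -/
noncomputable def incr (μ : Θ → ProbabilityMeasure (E d)) (θs θ : Θ) (u : Sph d) (t : ℝ) : ℝ :=
  projCDF (μ θ : Measure (E d)) u t - projCDF (μ θs : Measure (E d)) u t

/-- The rescaled criterion `θ ↦ ‖g - a (F_θ - F_{θ₀})‖_L`. -/
noncomputable def scaledCriterion (μ : Θ → ProbabilityMeasure (E d)) (θs : Θ) (a : ℝ)
    (g : SpaceL d) (θ : Θ) : ℝ≥0∞ :=
  normL (fun u t => g u t - a * incr μ θs θ u t)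

lemma aemeasurable_incr (μ : Θ → ProbabilityMeasure (E d)) (θs θ : Θ) (u : Sph d) :
    AEMeasurable (incr μ θs θ u) :=
  ((measurable_projCDF _ u).sub (measurable_projCDF _ u)).aemeasurable

lemma incr_self (μ : Θ → ProbabilityMeasure (E d)) (θs : Θ) (u : Sph d) (t : ℝ) :
    incr μ θs θs u t = 0 := sub_self _

lemma scaledCriterion_self_le (μ : Θ → ProbabilityMeasure (E d)) (θs : Θ) (a : ℝ)
    (g : SpaceL d) : scaledCriterion μ θs a g θs ≤ ‖g‖ₑ := by
  simpa [scaledCriterion, incr_self] using normL_coe_le g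

lemma WellSeparated.lt_normL_incr (hsep : WellSeparated μ θs) {ε : ℝ} (hε : 0 < ε) :
    ∃ δ : ℝ, 0 < δ ∧ ∀ θ : Θ, ε ≤ ‖(θ : E m) - θs‖ → ENNReal.ofReal δ < normL (incr μ θs θ) := by
  obtain ⟨δ, hδ, h⟩ := hsep ε hε
  refine ⟨δ, hδ, fun θ hθ => h.trans_le ((iInf₂_le θ hθ).trans (le_of_eq ?_))⟩
  rw [prw_one_one_eq, normL_sub_comm]
  rfl

/-- `‖a (F_θ - F_{θ₀})‖_L` is controlled by the rescaled criterion. -/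
lemma ofReal_mul_normL_incr_le (μ : Θ → ProbabilityMeasure (E d)) (θs θ : Θ) {a : ℝ} (ha : 0 ≤ a)
    (g : SpaceL d) :
    ENNReal.ofReal a * normL (incr μ θs θ) ≤ scaledCriterion μ θs a g θ + ‖g‖ₑ := by
  rw [← Real.enorm_eq_ofReal ha]
  have e : ‖a‖ₑ * normL (incr μ θs θ) = normL (fun u t => a * incr μ θs θ u t - 0) := by
    rw [← normL_const_mul]; simp
  rw [e, scaledCriterion, normL_sub_comm (fun u t => g u t)]
  refine (normL_sub_le (g := fun u t => g u t)
    (fun u => (aemeasurable_incr μ θs θ u).const_mul a) (aemeasurable_coe g)).trans ?_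
  gcongr
  simpa using normL_coe_le g

/-- The rescaled criterion and the limiting criterion differ by the linearization error. -/
lemma limitCriterion_le_scaledCriterion_add (hDm : ∀ u, Measurable (D u)) {a ε : ℝ} (ha : 0 ≤ a)
    (g : SpaceL d) (θ : Θ)
    (hθ : normL (fun u t => incr μ θs θ u t - inner ℝ ((θ : E m) - θs) (D u t))
      ≤ ENNReal.ofReal (ε * ‖(θ : E m) - θs‖)) :
    limitCriterion g D (a • ((θ : E m) - θs)) ≤
        scaledCriterion μ θs a g θ + ENNReal.ofReal (a * (ε * ‖(θ : E m) - θs‖)) ∧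
      scaledCriterion μ θs a g θ ≤
        limitCriterion g D (a • ((θ : E m) - θs)) +
          ENNReal.ofReal (a * (ε * ‖(θ : E m) - θs‖)) := by
  have e : normL (fun u t => a * incr μ θs θ u t - inner ℝ (a • ((θ : E m) - θs)) (D u t)) ≤
      ENNReal.ofReal (a * (ε * ‖(θ : E m) - θs‖)) := by
    simp only [real_inner_smul_left, ← mul_sub]
    rw [normL_const_mul, ENNReal.ofReal_mul ha, Real.enorm_eq_ofReal ha]
    gcongr
  constructor
  · exact (normL_sub_le (aemeasurable_coe g)
      (fun u => (aemeasurable_incr μ θs θ u).const_mul a)).trans (by gcongr; exact le_rfl)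
  · rw [normL_sub_comm] at e
    exact (normL_sub_le (aemeasurable_coe g)
      (fun u => (measurable_inner_apply hDm _ u).aemeasurable)).trans (by gcongr; exact le_rfl)

lemma enorm_le_ofReal {F : Type*} [SeminormedAddCommGroup F] {g : F} {K : ℝ} (h : ‖g‖ ≤ K) :
    ‖g‖ₑ ≤ ENNReal.ofReal K := by
  rw [← ofReal_norm]; exact ENNReal.ofReal_le_ofReal h

/-- Where the rescaled criterion is bounded it dominates the limiting criterion asymptotically. -/
lemma eventually_limitCriterion_le (hDm : ∀ u, Measurable (D u)) (hD : IsNormDerivative μ θs D)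
    (hsep : WellSeparated μ θs) {c : ℝ} (hc0 : 0 < c)
    (hc : ∀ h : E m, ENNReal.ofReal (c * ‖h‖) ≤ normL (fun u t => inner ℝ h (D u t)))
    {K η : ℝ} (hK : 0 ≤ K) (hη : 0 < η) :
    ∀ᶠ a : ℝ in atTop, ∀ g : SpaceL d, ‖g‖ ≤ K → ∀ θ : Θ,
      scaledCriterion μ θs a g θ ≤ ENNReal.ofReal (K + 1) →
      limitCriterion g D (a • ((θ : E m) - θs)) ≤
        scaledCriterion μ θs a g θ + ENNReal.ofReal η := by
  -- `B` will bound `a ‖θ - θ_⋆‖`. In the linearization tolerance, `c / 2` lets the error be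
  -- absorbed by the lower bound `c ‖θ - θ_⋆‖`, and `η / B` makes the final error at most `η`.
  set B := 2 * (2 * K + 1) / c with hB
  have hB0 : 0 < B := by positivity
  obtain ⟨δ, hδ, hδD⟩ := hD (min (c / 2) (η / B)) (by positivity)
  obtain ⟨δ', hδ', hδ'D⟩ := hsep.lt_normL_incr hδ
  filter_upwards [eventually_gt_atTop 0, eventually_ge_atTop ((2 * K + 1) / δ')]
    with a ha ha' g hg θ hθ
  have h1 : ENNReal.ofReal a * normL (incr μ θs θ) ≤ ENNReal.ofReal (2 * K + 1) := by
    refine (ofReal_mul_normL_incr_le μ θs θ ha.le g).trans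
      ((add_le_add hθ (enorm_le_ofReal hg)).trans ?_)
    rw [← ENNReal.ofReal_add (by positivity) hK]
    exact ENNReal.ofReal_le_ofReal (by linarith)
  have h2 : normL (incr μ θs θ) ≤ ENNReal.ofReal ((2 * K + 1) / a) := by
    rw [ENNReal.ofReal_div_of_pos ha, ENNReal.le_div_iff_mul_le
      (Or.inl (ENNReal.ofReal_pos.2 ha).ne') (Or.inl ENNReal.ofReal_ne_top), mul_comm]
    exact h1
  -- Separation localizes: the increment has norm at most `(2K + 1) / a ≤ δ'`, too small for a
  -- parameter at distance `δ` or more.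
  have h3 : ‖(θ : E m) - θs‖ < δ := by
    by_contra hcon
    have h4 := (hδ'D θ (not_lt.1 hcon)).trans_le h2
    rw [ENNReal.ofReal_lt_ofReal_iff_of_nonneg hδ'.le, lt_div_iff₀ ha] at h4
    rw [div_le_iff₀ hδ'] at ha'
    linarith
  have hR := hδD θ h3
  have h5 : ENNReal.ofReal (c * ‖(θ : E m) - θs‖) ≤
      ENNReal.ofReal ((2 * K + 1) / a + c / 2 * ‖(θ : E m) - θs‖) := by
    refine (hc _).trans ?_
    have h6 := normL_sub_le (f := fun u t => inner ℝ ((θ : E m) - θs) (D u t))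
      (g := incr μ θs θ) (h := fun _ _ => 0)
      (fun u => (measurable_inner_apply hDm _ u).aemeasurable) (aemeasurable_incr μ θs θ)
    simp only [sub_zero] at h6
    refine h6.trans ?_
    rw [add_comm, normL_sub_comm, ENNReal.ofReal_add (by positivity) (by positivity)]
    refine add_le_add h2 (hR.trans (ENNReal.ofReal_le_ofReal ?_))
    gcongr
    exact min_le_left _ _
  rw [ENNReal.ofReal_le_ofReal_iff (by positivity)] at h5
  have h7 : a * ‖(θ : E m) - θs‖ ≤ B := by
    have h8 : c / 2 * ‖(θ : E m) - θs‖ ≤ (2 * K + 1) / a := by linarith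
    rw [le_div_iff₀ ha] at h8
    rw [hB, le_div_iff₀ hc0]
    linarith
  refine (limitCriterion_le_scaledCriterion_add hDm ha.le g θ hR).1.trans ?_
  gcongr
  calc a * (min (c / 2) (η / B) * ‖(θ : E m) - θs‖)
      ≤ a * (η / B * ‖(θ : E m) - θs‖) := by gcongr; exact min_le_right _ _
    _ = η / B * (a * ‖(θ : E m) - θs‖) := by ring
    _ ≤ η / B * B := by gcongr
    _ = η := by field_simp

/-- The limiting criterion is coercive. -/
lemma mul_norm_le_of_limitCriterion_le (hDm : ∀ u, Measurable (D u)) {c : ℝ}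
    (hc : ∀ h : E m, ENNReal.ofReal (c * ‖h‖) ≤ normL (fun u t => inner ℝ h (D u t)))
    {K K' : ℝ} (hK' : 0 ≤ K') {g : SpaceL d} (hg : ‖g‖ ≤ K) {h : E m}
    (hh : limitCriterion g D h ≤ ENNReal.ofReal K') : c * ‖h‖ ≤ K' + K := by
  have hK : 0 ≤ K := (norm_nonneg g).trans hg
  have h2 := normL_sub_le (f := fun u t => inner ℝ h (D u t))
    (g := fun u t => g u t) (h := fun _ _ => 0)
    (fun u => (measurable_inner_apply hDm _ u).aemeasurable) (aemeasurable_coe g)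
  simp only [sub_zero] at h2
  rw [normL_sub_comm] at h2
  have h3 := (hc h).trans (h2.trans (add_le_add hh
    ((normL_coe_le g).trans (enorm_le_ofReal hg))))
  rwa [← ENNReal.ofReal_add hK' hK, ENNReal.ofReal_le_ofReal_iff (by positivity)] at h3

/-- Where the limiting criterion is bounded it dominates the rescaled criterion asymptotically. -/
lemma eventually_exists_scaledCriterion_le (hint : (θs : E m) ∈ interior Θ)
    (hDm : ∀ u, Measurable (D u)) (hD : IsNormDerivative μ θs D) {c : ℝ} (hc0 : 0 < c)
    (hc : ∀ h : E m, ENNReal.ofReal (c * ‖h‖) ≤ normL (fun u t => inner ℝ h (D u t)))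
    {K η : ℝ} (hK : 0 ≤ K) (hη : 0 < η) :
    ∀ᶠ a : ℝ in atTop, ∀ g : SpaceL d, ‖g‖ ≤ K → ∀ h : E m,
      limitCriterion g D h ≤ ENNReal.ofReal (K + 1) →
      ∃ θ : Θ, scaledCriterion μ θs a g θ ≤ limitCriterion g D h + ENNReal.ofReal η := by
  set B := (2 * K + 1) / c with hB
  have hB0 : 0 < B := by positivity
  obtain ⟨δ, hδ, hδD⟩ := hD (η / B) (by positivity)
  obtain ⟨r, hr, hrΘ⟩ := Metric.isOpen_iff.1 isOpen_interior _ hint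
  filter_upwards [eventually_gt_atTop 0, eventually_gt_atTop (B / δ), eventually_gt_atTop (B / r)]
    with a ha haδ har g hg h hh
  have h1 : ‖h‖ ≤ B := by
    rw [hB, le_div_iff₀ hc0]
    linarith [mul_norm_le_of_limitCriterion_le hDm hc (by positivity) hg hh]
  have hn : ‖a⁻¹ • h‖ = a⁻¹ * ‖h‖ := by rw [norm_smul, Real.norm_of_nonneg (by positivity)]
  have hlt : ∀ ρ : ℝ, 0 < ρ → B / ρ < a → ‖a⁻¹ • h‖ < ρ := by
    intro ρ hρ hρa
    rw [div_lt_iff₀ hρ] at hρa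
    rw [hn, inv_mul_lt_iff₀ ha]
    exact h1.trans_lt hρa
  -- The witness is `θ_⋆ + h / a`; it lies in `Θ` for large `a` since `‖h‖ ≤ B` and `θ_⋆` is
  -- interior.
  have hmem : (θs : E m) + a⁻¹ • h ∈ Θ :=
    interior_subset (hrΘ (by simpa using hlt r hr har))
  have e : (θs : E m) + a⁻¹ • h - θs = a⁻¹ • h := by simp
  refine ⟨⟨_, hmem⟩, ?_⟩
  have h4 := (limitCriterion_le_scaledCriterion_add hDm ha.le g ⟨_, hmem⟩
    (hδD ⟨_, hmem⟩ (by rw [e]; exact hlt δ hδ haδ))).2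
  simp only [e, smul_inv_smul₀ ha.ne'] at h4
  refine h4.trans ?_
  gcongr
  rw [hn]
  calc a * (η / B * (a⁻¹ * ‖h‖)) = η / B * ‖h‖ := by field_simp
    _ ≤ η / B * B := by gcongr
    _ = η := by field_simp

/-- The value of the limiting problem. -/
lemma iInf_limitCriterion_le (g : SpaceL d) (D : Sph d → ℝ → E m) :
    ⨅ h, limitCriterion g D h ≤ ‖g‖ₑ := by
  refine (iInf_le _ 0).trans ?_
  simpa [limitCriterion] using normL_coe_le g

/-- The rescaled minimal value is asymptotically equal to the value of the limiting problem,
uniformly on bounded sets. -/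
lemma eventually_abs_iInf_sub_le (hint : (θs : E m) ∈ interior Θ)
    (hDm : ∀ u, Measurable (D u)) (hD : IsNormDerivative μ θs D)
    (hsep : WellSeparated μ θs) {c : ℝ} (hc0 : 0 < c)
    (hc : ∀ h : E m, ENNReal.ofReal (c * ‖h‖) ≤ normL (fun u t => inner ℝ h (D u t)))
    {K η : ℝ} (hK : 0 ≤ K) (hη : 0 < η) :
    ∀ᶠ a : ℝ in atTop, ∀ g : SpaceL d, ‖g‖ ≤ K →
      ⨅ h, limitCriterion g D h ≤ (⨅ θ, scaledCriterion μ θs a g θ) + ENNReal.ofReal η ∧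
      ⨅ θ, scaledCriterion μ θs a g θ ≤ (⨅ h, limitCriterion g D h) + ENNReal.ofReal η := by
  filter_upwards [eventually_limitCriterion_le hDm hD hsep hc0 hc hK hη,
    eventually_exists_scaledCriterion_le hint hDm hD hc0 hc hK hη] with a h1 h2 g hg
  have hK1 : ENNReal.ofReal K ≤ ENNReal.ofReal (K + 1) := ENNReal.ofReal_le_ofReal (by linarith)
  constructor
  · rw [ENNReal.iInf_add]
    refine le_iInf fun θ => ?_
    -- Parameters with larger values are irrelevant: the limiting criterion at `0` is already at
    -- most `K`.
    by_cases hθ : scaledCriterion μ θs a g θ ≤ ENNReal.ofReal (K + 1)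
    · exact (iInf_le _ _).trans (h1 g hg θ hθ)
    · exact (iInf_limitCriterion_le g D).trans ((enorm_le_ofReal hg).trans
        (hK1.trans ((le_of_not_ge hθ).trans le_self_add)))
  · rw [ENNReal.iInf_add]
    refine le_iInf fun h => ?_
    by_cases hh : limitCriterion g D h ≤ ENNReal.ofReal (K + 1)
    · obtain ⟨θ, hθ⟩ := h2 g hg h hh
      exact (iInf_le _ θ).trans hθ
    · exact (iInf_le _ θs).trans ((scaledCriterion_self_le μ θs a g).trans
        ((enorm_le_ofReal hg).trans (hK1.trans ((le_of_not_ge hh).trans le_self_add))))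

/-! ### Existence and near-optimality of rescaled minimizers. -/

/-- Only countably many hyperplanes orthogonal to `u` carry mass. For every other `t` the half-space
has a null boundary, so weak convergence applies. -/
lemma ae_tendsto_projCDF (hμ : Continuous μ) {θ : Θ} {x : ℕ → Θ} (hx : Tendsto x atTop (𝓝 θ))
    (u : Sph d) :
    ∀ᵐ t : ℝ, Tendsto (fun k => projCDF (μ (x k) : Measure (E d)) u t) atTop
      (𝓝 (projCDF (μ θ : Measure (E d)) u t)) := by
  have hcont : Continuous fun y : E d => inner ℝ (u : E d) y := by fun_prop
  have hcount := Measure.countable_meas_level_set_pos (μ := (μ θ : Measure (E d)))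
    hcont.measurable
  filter_upwards [hcount.ae_notMem volume] with t ht
  have h0 : (μ θ : Measure (E d)) (frontier {y : E d | inner ℝ (u : E d) y ≤ t}) = 0 :=
    measure_mono_null (frontier_le_subset_eq hcont continuous_const) (by simpa using ht)
  exact (ENNReal.tendsto_toReal (measure_ne_top _ _)).comp
    (ProbabilityMeasure.tendsto_measure_of_null_frontier_of_tendsto'
      ((hμ.tendsto θ).comp hx) h0)

/-- For each `u`, Fatou's lemma along sequences of parameters gives lower semicontinuity, which
survives the supremum over `u`. -/
lemma lowerSemicontinuous_scaledCriterion (hμ : Continuous μ) (θs : Θ) (a : ℝ) (g : SpaceL d) :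
    LowerSemicontinuous (scaledCriterion μ θs a g) := by
  refine lowerSemicontinuous_iSup fun u θ y hy => ?_
  by_contra hcon
  obtain ⟨x, hx, hxy⟩ := exists_seq_forall_of_frequently (not_eventually.1 hcon)
  refine absurd hy (not_lt.2 ?_)
  refine (lintegral_enorm_le_liminf_of_tendsto (G := fun k t => g u t - a * incr μ θs (x k) u t)
    ?_ fun k => ((aemeasurable_coe g u).sub
      ((aemeasurable_incr μ θs (x k) u).const_mul a)).enorm).trans ?_
  · filter_upwards [ae_tendsto_projCDF hμ hx u] with t ht
    exact tendsto_const_nhds.sub ((ht.sub tendsto_const_nhds).const_mul a)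
  · refine (liminf_le_liminf (Eventually.of_forall fun k => not_lt.1 (hxy k))).trans ?_
    simp

/-- The rescaled criterion has a minimizer for large scales, uniformly on bounded sets. -/
lemma eventually_nonempty_argmin (hμ : Continuous μ) (hint : (θs : E m) ∈ interior Θ)
    (hsep : WellSeparated μ θs) {K : ℝ} (hK : 0 ≤ K) :
    ∀ᶠ a : ℝ in atTop, ∀ g : SpaceL d, ‖g‖ ≤ K → (argmin (scaledCriterion μ θs a g)).Nonempty := by
  obtain ⟨r, hr, hrΘ⟩ := Metric.nhds_basis_closedBall.mem_iff.1 (isOpen_interior.mem_nhds hint)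
  obtain ⟨δ, hδ, hδD⟩ := hsep.lt_normL_incr hr
  filter_upwards [eventually_gt_atTop 0, eventually_ge_atTop (2 * K / δ)] with a ha haδ g hg
  -- `Θ` need not be closed, but a small closed ball around the interior point `θ_⋆` lies in it.
  -- Outside the ball the criterion is at least `K`, hence at least its value at `θ_⋆`, so a
  -- minimizer on the ball is global.
  have hcomp : IsCompact ((↑) ⁻¹' Metric.closedBall (θs : E m) r : Set Θ) := by
    rw [Subtype.isCompact_iff, Set.image_preimage_eq_of_subset]
    · exact isCompact_closedBall _ _
    · simpa using hrΘ.trans interior_subset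
  obtain ⟨θ₀, -, hmin⟩ := LowerSemicontinuousOn.exists_isMinOn
    ⟨θs, by simpa using hr.le⟩ hcomp
    ((lowerSemicontinuous_scaledCriterion hμ θs a g).lowerSemicontinuousOn _)
  refine ⟨θ₀, fun θ => ?_⟩
  by_cases hθ : θ ∈ ((↑) ⁻¹' Metric.closedBall (θs : E m) r : Set Θ)
  · exact hmin hθ
  · have hfar : r ≤ ‖(θ : E m) - θs‖ := by
      rw [Set.mem_preimage, Metric.mem_closedBall, dist_eq_norm] at hθ
      exact (not_le.1 hθ).le
    have h1 := ofReal_mul_normL_incr_le μ θs θ ha.le g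
    have h2 : ENNReal.ofReal K + ENNReal.ofReal K ≤
        scaledCriterion μ θs a g θ + ENNReal.ofReal K := by
      refine le_trans ?_ ((mul_le_mul_right (hδD θ hfar).le _).trans
        (h1.trans (add_le_add le_rfl (enorm_le_ofReal hg))))
      rw [← ENNReal.ofReal_add hK hK, ← ENNReal.ofReal_mul ha.le]
      refine ENNReal.ofReal_le_ofReal ?_
      rw [div_le_iff₀ hδ] at haδ
      linarith
    have h3 := (ENNReal.add_le_add_iff_right ENNReal.ofReal_ne_top).1 h2
    refine le_trans ?_ ((scaledCriterion_self_le μ θs a g).trans ((enorm_le_ofReal hg).trans h3))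
    exact hmin (by simpa using hr.le)

/-- Rescaled minimizers nearly minimize the limiting criterion. -/
lemma eventually_limitCriterion_le_of_mem_argmin (hint : (θs : E m) ∈ interior Θ)
    (hDm : ∀ u, Measurable (D u)) (hD : IsNormDerivative μ θs D)
    (hsep : WellSeparated μ θs) {c : ℝ} (hc0 : 0 < c)
    (hc : ∀ h : E m, ENNReal.ofReal (c * ‖h‖) ≤ normL (fun u t => inner ℝ h (D u t)))
    {K η : ℝ} (hK : 0 ≤ K) (hη : 0 < η) :
    ∀ᶠ a : ℝ in atTop, ∀ g : SpaceL d, ‖g‖ ≤ K → ∀ θ ∈ argmin (scaledCriterion μ θs a g),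
      limitCriterion g D (a • ((θ : E m) - θs)) ≤
        (⨅ h, limitCriterion g D h) + ENNReal.ofReal η := by
  filter_upwards [eventually_limitCriterion_le hDm hD hsep hc0 hc hK (half_pos hη),
    eventually_abs_iInf_sub_le hint hDm hD hsep hc0 hc hK (half_pos hη)] with a h1 h2 g hg θ hθ
  have h3 : scaledCriterion μ θs a g θ ≤ ENNReal.ofReal (K + 1) :=
    (hθ θs).trans ((scaledCriterion_self_le μ θs a g).trans
      ((enorm_le_ofReal hg).trans (ENNReal.ofReal_le_ofReal (by linarith))))
  have h4 : ENNReal.ofReal η = ENNReal.ofReal (η / 2) + ENNReal.ofReal (η / 2) := by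
    rw [← ENNReal.ofReal_add (by positivity) (by positivity), add_halves]
  refine (h1 g hg θ h3).trans ?_
  rw [h4, ← add_assoc]
  refine add_le_add ?_ le_rfl
  exact (le_iInf hθ).trans (h2 g hg).2

end LocalAsymptotics

/-! ### Portmanteau bounds and tightness. -/

section Distribution

variable {Ω Ω' S : Type*} [MeasurableSpace Ω] {P : Measure Ω} [IsProbabilityMeasure P]
  [MeasurableSpace Ω'] {P' : Measure Ω'} [IsProbabilityMeasure P']

lemma limsup_preimage_closed_le [TopologicalSpace S] [HasOuterApproxClosed S] [MeasurableSpace S]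
    [OpensMeasurableSpace S] {X : ℕ → Ω → S} {Z : Ω' → S}
    (h : TendstoInDistribution X atTop Z (fun _ => P) P') {F : Set S} (hF : IsClosed F) :
    limsup (fun n => P (X n ⁻¹' F)) atTop ≤ P' (Z ⁻¹' F) := by
  have h1 := ProbabilityMeasure.limsup_measure_closed_le_of_tendsto h.tendsto hF
  simp only [ProbabilityMeasure.coe_mk] at h1
  rw [Measure.map_apply_of_aemeasurable h.aemeasurable_limit hF.measurableSet] at h1
  simpa only [Measure.map_apply_of_aemeasurable (h.forall_aemeasurable _) hF.measurableSet]
    using h1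

lemma eventually_preimage_closed_le [TopologicalSpace S] [HasOuterApproxClosed S]
    [MeasurableSpace S] [OpensMeasurableSpace S] {X : ℕ → Ω → S} {Z : Ω' → S}
    (h : TendstoInDistribution X atTop Z (fun _ => P) P') {F : Set S} (hF : IsClosed F)
    {b : ℝ≥0∞} (hb : P' (Z ⁻¹' F) < b) :
    ∀ᶠ n in atTop, P (X n ⁻¹' F) ≤ b :=
  (eventually_lt_of_limsup_lt ((limsup_preimage_closed_le h hF).trans_lt hb)).mono
    fun _ => le_of_lt

/-- A sequence that converges in distribution is bounded in probability. -/
lemma exists_eventually_norm_le [SeminormedAddCommGroup S] [MeasurableSpace S] [BorelSpace S]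
    {X : ℕ → Ω → S} {Z : Ω' → S}
    (h : TendstoInDistribution X atTop Z (fun _ => P) P') {ε : ℝ≥0∞} (hε : 0 < ε) :
    ∃ K : ℝ, 0 ≤ K ∧ ∀ᶠ n in atTop, P {ω | K < ‖X n ω‖} ≤ ε := by
  have hcl : ∀ k : ℕ, IsClosed {x : S | (k : ℝ) ≤ ‖x‖} := fun k =>
    isClosed_le continuous_const continuous_norm
  have hanti : Antitone fun k : ℕ => Z ⁻¹' {x : S | (k : ℝ) ≤ ‖x‖} := fun i j hij =>
    Set.preimage_mono fun x (hx : (j : ℝ) ≤ ‖x‖) => le_trans (Nat.cast_le.2 hij) hx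
  have hlim := tendsto_measure_iInter_atTop (μ := P')
    (fun k => h.aemeasurable_limit.nullMeasurableSet_preimage (hcl k).measurableSet) hanti
    ⟨0, measure_ne_top _ _⟩
  have hempty : ⋂ k : ℕ, Z ⁻¹' {x : S | (k : ℝ) ≤ ‖x‖} = ∅ := by
    refine Set.eq_empty_of_forall_notMem fun ω hω => ?_
    obtain ⟨k, hk⟩ := exists_nat_gt ‖Z ω‖
    exact absurd (Set.mem_iInter.1 hω k) (not_le.2 hk)
  rw [hempty, measure_empty] at hlim
  obtain ⟨k, hk⟩ := (hlim.eventually (gt_mem_nhds hε)).exists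
  refine ⟨k, k.cast_nonneg, (eventually_preimage_closed_le h (hcl k) hk).mono fun n hn =>
    (measure_mono fun ω (hω : (k : ℝ) < ‖X n ω‖) => ?_).trans hn⟩
  exact hω.le

end Distribution

/-! ### Closed sets of `g` encoding the position of the argmin. -/

section NearMinimizers

variable {d m : ℕ} {D : Sph d → ℝ → E m}

/-- The functions `g` whose limiting criterion has an infimum over `C` within `η` of its infimum. -/
def nearMinimizedOn (D : Sph d → ℝ → E m) (C : Set (E m)) (η : ℝ) : Set (SpaceL d) :=
  {g | ⨅ h : C, limitCriterion g D h ≤ (⨅ h, limitCriterion g D h) + ENNReal.ofReal η}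

/-- Both infima are distances to families of functions, hence continuous in `g`. Closedness is what
lets the portmanteau theorem act directly on `g`. -/
lemma isClosed_nearMinimizedOn (D : Sph d → ℝ → E m) (C : Set (E m)) (η : ℝ) :
    IsClosed (nearMinimizedOn D C η) :=
  isClosed_le (continuous_infDistL fun (h : C) u t => inner ℝ (h : E m) (D u t))
    ((continuous_infDistL fun (h : E m) u t => inner ℝ h (D u t)).add continuous_const)

lemma nearMinimizedOn_mono (D : Sph d → ℝ → E m) (C : Set (E m)) {η η' : ℝ} (h : η ≤ η') :
    nearMinimizedOn D C η ⊆ nearMinimizedOn D C η' := fun _ hg =>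
  le_trans hg (add_le_add le_rfl (ENNReal.ofReal_le_ofReal h))

lemma iInter_nearMinimizedOn (D : Sph d → ℝ → E m) (C : Set (E m)) :
    ⋂ k : ℕ, nearMinimizedOn D C (1 / ((k : ℝ) + 1)) = nearMinimizedOn D C 0 := by
  refine Set.Subset.antisymm (fun g hg => ?_) (Set.subset_iInter fun k =>
    nearMinimizedOn_mono D C (by positivity))
  have hlim : Tendsto (fun k : ℕ => (⨅ h, limitCriterion g D h) +
      ENNReal.ofReal (1 / ((k : ℝ) + 1))) atTop
      (𝓝 ((⨅ h, limitCriterion g D h) + ENNReal.ofReal 0)) :=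
    tendsto_const_nhds.add (ENNReal.tendsto_ofReal tendsto_one_div_add_atTop_nhds_zero_nat)
  exact ge_of_tendsto' hlim fun k => Set.mem_iInter.1 hg k

lemma mem_nearMinimizedOn_zero_of_mem_argmin {C : Set (E m)} {g : SpaceL d} {h : E m} (hC : h ∈ C)
    (hh : h ∈ argmin (limitCriterion g D)) : g ∈ nearMinimizedOn D C 0 := by
  rw [nearMinimizedOn, Set.mem_ofPred_eq, ENNReal.ofReal_zero, add_zero]
  exact (iInf_le (fun h : C => limitCriterion g D h) ⟨h, hC⟩).trans (le_iInf hh)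

/-- Coercivity, from the lower bound `c`, reduces the infimum over `C` to a compact set; continuity,
from the upper bound `B`, makes it attained there. -/
lemma exists_mem_argmin_of_mem_nearMinimizedOn_zero (hDm : ∀ u, Measurable (D u)) {c B : ℝ}
    (hc0 : 0 < c)
    (hc : ∀ h : E m, ENNReal.ofReal (c * ‖h‖) ≤ normL (fun u t => inner ℝ h (D u t)))
    (hB0 : 0 ≤ B)
    (hB : ∀ h : E m, normL (fun u t => inner ℝ h (D u t)) ≤ ENNReal.ofReal (B * ‖h‖))
    {C : Set (E m)} (hC : IsClosed C) {g : SpaceL d} (hg : g ∈ nearMinimizedOn D C 0) :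
    ∃ h ∈ C, h ∈ argmin (limitCriterion g D) := by
  rw [nearMinimizedOn, Set.mem_ofPred_eq, ENNReal.ofReal_zero, add_zero] at hg
  have hlt : ⨅ h : C, limitCriterion g D h < ENNReal.ofReal (‖g‖ + 1) := by
    refine (hg.trans (iInf_limitCriterion_le g D)).trans_lt ?_
    rw [← ofReal_norm, ENNReal.ofReal_lt_ofReal_iff_of_nonneg (norm_nonneg g)]
    linarith
  have hball : ∀ h : E m, limitCriterion g D h < ENNReal.ofReal (‖g‖ + 1) →
      h ∈ Metric.closedBall (0 : E m) ((2 * ‖g‖ + 1) / c) := by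
    intro h hh
    rw [mem_closedBall_zero_iff, le_div_iff₀ hc0]
    linarith [mul_norm_le_of_limitCriterion_le hDm hc (by positivity) le_rfl hh.le]
  obtain ⟨⟨h₁, h₁C⟩, hh₁⟩ := iInf_lt_iff.1 hlt
  obtain ⟨h₀, hh₀, hmin⟩ := ((isCompact_closedBall (0 : E m) ((2 * ‖g‖ + 1) / c)).inter_left
    hC).exists_isMinOn ⟨h₁, h₁C, hball h₁ hh₁⟩
    (continuous_limitCriterion hDm hB0 hB g).continuousOn
  refine ⟨h₀, hh₀.1, fun b => ?_⟩
  refine le_trans ?_ (hg.trans (iInf_le _ b))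
  by_contra hcon
  obtain ⟨⟨h, hhC⟩, hh⟩ := iInf_lt_iff.1 (lt_min (not_le.1 hcon) hlt)
  exact absurd (hmin ⟨hhC, hball h (hh.trans_le (min_le_right _ _))⟩)
    (not_le.2 (hh.trans_le (min_le_left _ _)))

end NearMinimizers

/-! ### Translation from empirical measures to elements of `L`. -/

section Empirical

variable {d m : ℕ} {Θ : Set (E m)} {μ : Θ → ProbabilityMeasure (E d)} {θs : Θ}

/-- `F_⋆` cancels between `g` and the increment, leaving `√n (F̂_n - F_θ)`. -/
lemma scaledCriterion_eq_mul_prw {n : ℕ} (hn : n ≠ 0) (x : ℕ → E d) {g : SpaceL d}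
    (hg : Represents g fun u t =>
      √(n : ℝ) * (empCDF n x u t - projCDF (μ θs : Measure (E d)) u t)) (θ : Θ) :
    scaledCriterion μ θs √(n : ℝ) g θ =
      ENNReal.ofReal √(n : ℝ) * prw 1 1 (empirical n x) (μ θ : Measure (E d)) := by
  have : NeZero n := ⟨hn⟩
  rw [prw_one_one_eq, ← Real.enorm_eq_ofReal (Real.sqrt_nonneg _), ← normL_const_mul]
  refine normL_congr fun u => ?_
  filter_upwards [hg u] with t ht
  rw [ht, projCDF_empirical, incr]
  ring

lemma ofReal_sqrt_natCast_ne_zero {n : ℕ} (hn : n ≠ 0) : ENNReal.ofReal √(n : ℝ) ≠ 0 := by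
  have : 0 < √(n : ℝ) := Real.sqrt_pos.2 (Nat.cast_pos.2 (Nat.pos_of_ne_zero hn))
  exact (ENNReal.ofReal_pos.2 this).ne'

lemma iInf_scaledCriterion_eq {n : ℕ} (hn : n ≠ 0) (x : ℕ → E d) {g : SpaceL d}
    (hg : Represents g fun u t =>
      √(n : ℝ) * (empCDF n x u t - projCDF (μ θs : Measure (E d)) u t)) :
    ⨅ θ, scaledCriterion μ θs √(n : ℝ) g θ =
      ENNReal.ofReal √(n : ℝ) * ⨅ θ, prw 1 1 (empirical n x) (μ θ : Measure (E d)) := by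
  rw [ENNReal.mul_iInf_of_ne (ofReal_sqrt_natCast_ne_zero hn) ENNReal.ofReal_ne_top]
  exact iInf_congr fun θ => scaledCriterion_eq_mul_prw hn x hg θ

lemma argmin_scaledCriterion_eq {n : ℕ} (hn : n ≠ 0) (x : ℕ → E d) {g : SpaceL d}
    (hg : Represents g fun u t =>
      √(n : ℝ) * (empCDF n x u t - projCDF (μ θs : Measure (E d)) u t)) :
    argmin (scaledCriterion μ θs √(n : ℝ) g) =
      argmin fun θ => prw 1 1 (empirical n x) (μ θ : Measure (E d)) := by
  ext θ
  refine forall_congr' fun θ' => ?_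
  rw [scaledCriterion_eq_mul_prw hn x hg, scaledCriterion_eq_mul_prw hn x hg,
    ENNReal.mul_le_mul_iff_right (ofReal_sqrt_natCast_ne_zero hn) ENNReal.ofReal_ne_top]

lemma iInf_scaledCriterion_lt_top (a : ℝ) (g : SpaceL d) :
    ⨅ θ, scaledCriterion μ θs a g θ < ∞ :=
  (iInf_le _ θs).trans_lt ((scaledCriterion_self_le μ θs a g).trans_lt enorm_lt_top)

lemma iInf_limitCriterion_lt_top (D : Sph d → ℝ → E m) (g : SpaceL d) :
    ⨅ h, limitCriterion g D h < ∞ :=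
  (iInf_limitCriterion_le g D).trans_lt enorm_lt_top

lemma continuous_toReal_iInf_scaledCriterion (μ : Θ → ProbabilityMeasure (E d)) (θs : Θ) (a : ℝ) :
    Continuous fun g => (⨅ θ, scaledCriterion μ θs a g θ).toReal :=
  continuous_toReal_infDistL (f := fun θ u t => a * incr μ θs θ u t) θs
    (by simp [incr_self, normL])

lemma continuous_toReal_iInf_limitCriterion (D : Sph d → ℝ → E m) :
    Continuous fun g => (⨅ h, limitCriterion g D h).toReal :=
  continuous_toReal_infDistL (f := fun (h : E m) u t => inner ℝ h (D u t)) 0 (by simp [normL])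

lemma normL_empCDF_sub_lt_top {n : ℕ} (hn : n ≠ 0) (x : ℕ → E d) {ν : Measure (E d)} {g : SpaceL d}
    (hg : Represents g fun u t => √(n : ℝ) * (empCDF n x u t - projCDF ν u t)) :
    normL (fun u t => empCDF n x u t - projCDF ν u t) < ∞ := by
  have h1 := normL_coe_lt_top g
  rw [normL_congr hg, normL_const_mul] at h1
  refine ENNReal.lt_top_of_mul_ne_top_right h1.ne ?_
  rw [Real.enorm_eq_ofReal (Real.sqrt_nonneg _)]
  exact ofReal_sqrt_natCast_ne_zero hn

/-- The bounds above and below that the norm derivative of a nonsingular model satisfies. -/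
lemma exists_normL_inner_bounds {D : Sph d → ℝ → E m} (hint : (θs : E m) ∈ interior Θ)
    (hDm : ∀ u, Measurable (D u)) (hD : IsNormDerivative μ θs D) (hDns : Nonsingular D)
    (x : ℕ → E d) {g : SpaceL d}
    (hg : Represents g fun u t =>
      √((1 : ℕ) : ℝ) * (empCDF 1 x u t - projCDF (μ θs : Measure (E d)) u t)) :
    (∃ B : ℝ, 0 ≤ B ∧
      ∀ h : E m, normL (fun u t => inner ℝ h (D u t)) ≤ ENNReal.ofReal (B * ‖h‖)) ∧
    ∃ c : ℝ, 0 < c ∧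
      ∀ h : E m, ENNReal.ofReal (c * ‖h‖) ≤ normL (fun u t => inner ℝ h (D u t)) := by
  -- The distribution function of a single observation takes only the values `0` and `1`, and its
  -- distance to `F_⋆` is finite because the difference is represented in `L`.
  obtain ⟨B, hB0, hB⟩ := exists_normL_inner_le hint hDm hD (empCDF 1 x)
    (fun u t => by
      by_cases h : inner ℝ (u : E d) (x 0) ≤ t <;> simp [empCDF, Finset.filter_singleton, h])
    (fun u => by
      have : empCDF 1 x u = projCDF (empirical 1 x) u := by
        ext t; rw [projCDF_empirical]
      rw [this]
      exact (measurable_projCDF _ u).aemeasurable)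
    (normL_empCDF_sub_lt_top one_ne_zero x hg)
  exact ⟨⟨B, hB0, hB⟩, exists_le_normL_inner hDm hB0 hB hDns⟩

end Empirical

/-! ### Convergence in distribution of the value and of the estimator. -/

section Convergence

variable {d m : ℕ} {Θ : Set (E m)} (μ : Θ → ProbabilityMeasure (E d)) {Ω Ω' : Type*}
  [MeasurableSpace Ω] {P : Measure Ω} [IsProbabilityMeasure P] {X : ℕ → Ω → E d}
  (θs : Θ) {D : Sph d → ℝ → E m} [MeasurableSpace Ω'] {P' : Measure Ω'} [IsProbabilityMeasure P']
  {G : Ω' → SpaceL d} {g : ℕ → Ω → SpaceL d}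

lemma tendsto_sqrt_natCast_atTop : Tendsto (fun n : ℕ => √(n : ℝ)) atTop atTop :=
  Real.tendsto_sqrt_atTop.comp tendsto_natCast_atTop_atTop

lemma abs_toReal_sub_toReal_le {x y : ℝ≥0∞} (hx : x ≠ ∞) (hy : y ≠ ∞) {η : ℝ} (hη : 0 ≤ η)
    (h1 : x ≤ y + ENNReal.ofReal η) (h2 : y ≤ x + ENNReal.ofReal η) :
    |x.toReal - y.toReal| ≤ η := by
  have e1 := ENNReal.toReal_mono (ENNReal.add_ne_top.2 ⟨hy, ENNReal.ofReal_ne_top⟩) h1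
  have e2 := ENNReal.toReal_mono (ENNReal.add_ne_top.2 ⟨hx, ENNReal.ofReal_ne_top⟩) h2
  rw [ENNReal.toReal_add hy ENNReal.ofReal_ne_top, ENNReal.toReal_ofReal hη] at e1
  rw [ENNReal.toReal_add hx ENNReal.ofReal_ne_top, ENNReal.toReal_ofReal hη] at e2
  rw [abs_le]
  constructor <;> linarith

/-- Convergence in distribution of the rescaled minimal distance. -/
theorem tendstoInDistribution_minValue (hint : (θs : E m) ∈ interior Θ)
    (hsep : WellSeparated μ θs) (hDm : ∀ u, Measurable (D u)) (hD : IsNormDerivative μ θs D)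
    {c : ℝ} (hc0 : 0 < c)
    (hc : ∀ h : E m, ENNReal.ofReal (c * ‖h‖) ≤ normL (fun u t => inner ℝ h (D u t)))
    (hg : ∀ n ω, Represents (g n ω) fun u t => √(n : ℝ) * (empCDF n (fun i => X i ω) u t
      - projCDF (μ θs : Measure (E d)) u t))
    (hgG : TendstoInDistribution g atTop G (fun _ => P) P') :
    TendstoInDistribution
      (fun (n : ℕ) ω => √(n : ℝ) * (⨅ θ : Θ, prw 1 1 (empirical n (fun i => X i ω))
        (μ θ : Measure (E d))).toReal)
      atTop (fun ω' => (⨅ θ : E m, limitCriterion (G ω') D θ).toReal) (fun _ => P) P' := by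
  have hval : ∀ n : ℕ, n ≠ 0 → ∀ ω, √(n : ℝ) * (⨅ θ : Θ, prw 1 1 (empirical n (fun i => X i ω))
      (μ θ : Measure (E d))).toReal =
      (⨅ θ, scaledCriterion μ θs √(n : ℝ) (g n ω) θ).toReal := by
    intro n hn ω
    rw [iInf_scaledCriterion_eq hn _ (hg n ω), ENNReal.toReal_mul,
      ENNReal.toReal_ofReal (Real.sqrt_nonneg _)]
  have hlim : TendstoInDistribution (fun n ω => (⨅ h, limitCriterion (g n ω) D h).toReal) atTop
      (fun ω' => (⨅ h, limitCriterion (G ω') D h).toReal) (fun _ => P) P' :=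
    hgG.continuous_comp (g := fun g => (⨅ h, limitCriterion g D h).toReal)
      (continuous_toReal_iInf_limitCriterion D)
  -- Slutsky: outside the event `‖g n‖ > K`, of small probability by tightness, the deterministic
  -- comparison bounds the difference by `ε / 2`.
  refine tendstoInDistribution_of_tendstoInMeasure_sub _ _ hlim ?_ fun n => ?_
  · rw [tendstoInMeasure_iff_norm]
    intro ε hε
    rw [ENNReal.tendsto_nhds_zero]
    intro ε' hε'
    obtain ⟨K, hK, htight⟩ := exists_eventually_norm_le hgG hε'
    filter_upwards [htight, eventually_ne_atTop 0, tendsto_sqrt_natCast_atTop.eventually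
      (eventually_abs_iInf_sub_le hint hDm hD hsep hc0 hc hK (half_pos hε))] with n h1 hn h2
    refine (measure_mono fun ω hω => ?_).trans h1
    by_contra hcon
    obtain ⟨h3, h4⟩ := h2 (g n ω) (not_lt.1 hcon)
    have h5 := abs_toReal_sub_toReal_le (iInf_scaledCriterion_lt_top (θs := θs) _ _).ne
      (iInf_limitCriterion_lt_top D (g n ω)).ne (half_pos hε).le h4 h3
    simp only [Set.mem_ofPred_eq, Pi.sub_apply, Pi.zero_apply, sub_zero,
      hval n hn ω, Real.norm_eq_abs] at hω
    linarith
  · rcases eq_or_ne n 0 with rfl | hn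
    · simp
    · simp_rw [hval n hn]
      exact (continuous_toReal_iInf_scaledCriterion μ θs _).measurable.comp_aemeasurable
        (hgG.forall_aemeasurable n)

variable {θs}

/-- Convergence in distribution of the rescaled minimum distance estimators. -/
theorem tendstoInDistribution_minimizer (hμ : Continuous μ) (hint : (θs : E m) ∈ interior Θ)
    (hsep : WellSeparated μ θs) (hDm : ∀ u, Measurable (D u)) (hD : IsNormDerivative μ θs D)
    {c B : ℝ} (hc0 : 0 < c)
    (hc : ∀ h : E m, ENNReal.ofReal (c * ‖h‖) ≤ normL (fun u t => inner ℝ h (D u t)))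
    (hB0 : 0 ≤ B)
    (hB : ∀ h : E m, normL (fun u t => inner ℝ h (D u t)) ≤ ENNReal.ofReal (B * ‖h‖))
    (hg : ∀ n ω, Represents (g n ω) fun u t => √(n : ℝ) * (empCDF n (fun i => X i ω) u t
      - projCDF (μ θs : Measure (E d)) u t))
    (hgG : TendstoInDistribution g atTop G (fun _ => P) P')
    (huniq : ∀ᵐ ω' ∂P', ∃! θ : E m, θ ∈ argmin (limitCriterion (G ω') D))
    {θhat : ℕ → Ω → Θ} (hθm : ∀ n, Measurable (θhat n))
    (hθ : ∀ n ω, (argmin (fun θ : Θ => prw 1 1 (empirical n (fun i => X i ω))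
        (μ θ : Measure (E d)))).Nonempty →
      θhat n ω ∈ argmin (fun θ : Θ => prw 1 1 (empirical n (fun i => X i ω))
        (μ θ : Measure (E d))))
    {Z : Ω' → E m} (hZ : ∀ᵐ ω' ∂P', Z ω' ∈ argmin (limitCriterion (G ω') D)) :
    TendstoInDistribution (fun (n : ℕ) ω => √(n : ℝ) • ((θhat n ω : E m) - (θs : E m)))
      atTop Z (fun _ => P) P' := by
  -- Uniqueness makes the event `Z ∈ C` almost surely equal to a closed condition on `G`. This
  -- yields both the measurability of `Z` and the limit probabilities for the portmanteau criterion.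
  have hpre : ∀ C : Set (E m), IsClosed C →
      Z ⁻¹' C =ᵐ[P'] G ⁻¹' nearMinimizedOn D C 0 := by
    intro C hC
    filter_upwards [huniq, hZ] with ω hu hz
    refine propext ⟨fun h => mem_nearMinimizedOn_zero_of_mem_argmin h hz, fun h => ?_⟩
    obtain ⟨h₀, h₀C, h₀min⟩ :=
      exists_mem_argmin_of_mem_nearMinimizedOn_zero hDm hc0 hc hB0 hB hC h
    change Z ω ∈ C
    rwa [hu.unique hz h₀min]
  have hZm : AEMeasurable Z P' := by
    refine NullMeasurable.aemeasurable ?_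
    have h1 : @Measurable (NullMeasurableSpace Ω' P') (E m) _ _ Z :=
      measurable_of_isClosed fun C hC => NullMeasurableSet.congr
        (hgG.aemeasurable_limit.nullMeasurableSet_preimage
          (isClosed_nearMinimizedOn D C 0).measurableSet) (hpre C hC).symm
    exact fun s hs => h1 hs
  have hXm : ∀ n : ℕ, Measurable fun ω => √(n : ℝ) • ((θhat n ω : E m) - (θs : E m)) := fun n => by
    have := hθm n
    fun_prop
  refine ⟨fun n => (hXm n).aemeasurable, hZm, tendsto_of_forall_isClosed_limsup_le' fun C hC => ?_⟩
  simp only [ProbabilityMeasure.coe_mk]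
  rw [Measure.map_apply_of_aemeasurable hZm hC.measurableSet, measure_congr (hpre C hC)]
  simp only [Measure.map_apply (hXm _) hC.measurableSet]
  refine ENNReal.le_of_forall_pos_le_add fun ε hε _ => ?_
  have hε3 : 0 < (ε : ℝ≥0∞) / 3 := by
    have : (ε : ℝ≥0∞) ≠ 0 := by exact_mod_cast hε.ne'
    exact ENNReal.div_pos this (by norm_num)
  have hlim := tendsto_measure_iInter_atTop (μ := P')
    (s := fun k : ℕ => G ⁻¹' nearMinimizedOn D C (1 / ((k : ℝ) + 1)))
    (fun k => hgG.aemeasurable_limit.nullMeasurableSet_preimage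
      (isClosed_nearMinimizedOn D C _).measurableSet)
    (fun i j hij => Set.preimage_mono (nearMinimizedOn_mono D C (by gcongr)))
    ⟨0, measure_ne_top _ _⟩
  rw [← Set.preimage_iInter, iInter_nearMinimizedOn] at hlim
  set b := P' (G ⁻¹' nearMinimizedOn D C 0) with hb
  -- Continuity from above: a tolerance `1 / (k + 1)` is fixed before `n → ∞`, costing at most `ε /
  -- 3` in probability.
  obtain ⟨k, hk⟩ := (hlim.eventually (gt_mem_nhds
    (ENNReal.lt_add_right (measure_ne_top P' _) hε3.ne'))).exists
  obtain ⟨K, hK, htight⟩ := exists_eventually_norm_le hgG hε3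
  have hη : (0 : ℝ) < 1 / ((k : ℝ) + 1) := by positivity
  refine limsup_le_of_le (by isBoundedDefault) ?_
  filter_upwards [htight, eventually_preimage_closed_le hgG (isClosed_nearMinimizedOn D C _) hk,
    eventually_ne_atTop 0,
    tendsto_sqrt_natCast_atTop.eventually (eventually_nonempty_argmin hμ hint hsep hK),
    tendsto_sqrt_natCast_atTop.eventually
      (eventually_limitCriterion_le_of_mem_argmin hint hDm hD hsep hc0 hc hK hη)]
    with n h1 h2 hn h3 h4
  -- When `‖g n‖ ≤ K`, a minimizer exists, so the estimator is one, and its rescaling is a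
  -- near-minimizer of the limiting criterion lying in `C`.
  have hsub : (fun ω => √(n : ℝ) • ((θhat n ω : E m) - (θs : E m))) ⁻¹' C ⊆
      g n ⁻¹' nearMinimizedOn D C (1 / ((k : ℝ) + 1)) ∪ {ω | K < ‖g n ω‖} := by
    intro ω hω
    by_cases hn' : K < ‖g n ω‖
    · exact Or.inr hn'
    · left
      have h5 := h3 (g n ω) (not_lt.1 hn')
      have h6 := argmin_scaledCriterion_eq hn _ (hg n ω)
      have h7 := hθ n ω (h6 ▸ h5)
      rw [← h6] at h7
      exact (iInf_le (fun h : C => limitCriterion (g n ω) D h) ⟨_, hω⟩).trans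
        (h4 (g n ω) (not_lt.1 hn') _ h7)
  calc P _ ≤ _ := measure_mono hsub
    _ ≤ _ := measure_union_le _ _
    _ ≤ (b + ε / 3) + ε / 3 := add_le_add h2 h1
    _ ≤ b + ε := by
      rw [add_assoc]
      refine add_le_add le_rfl ?_
      calc (ε : ℝ≥0∞) / 3 + ε / 3 ≤ ε / 3 + ε / 3 + ε / 3 := le_self_add
        _ = ε := ENNReal.add_thirds _

end Convergence

end PRW
theorem mainTheorem12
    {d m : ℕ} (hd : 1 ≤ d)
    -- the model
    {Θ : Set (PRW.E m)} (μ : Θ → ProbabilityMeasure (PRW.E d))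
    -- the data
    {Ω : Type*} [MeasurableSpace Ω] (P : Measure Ω) [IsProbabilityMeasure P]
    (X : ℕ → Ω → PRW.E d) (hX : ∀ i, Measurable (X i))
    (μs : ProbabilityMeasure (PRW.E d))
    -- almost sure convergence of the empirical measures
    (hA1 : ∀ᵐ ω ∂P, Tendsto
      (fun n => PRW.wasserstein 1 (PRW.empirical n (fun i => X i ω)) (μs : Measure (PRW.E d)))
      atTop (𝓝 0))
    -- weak continuity of the model
    (hA2 : Continuous μ)
    -- boundedness of the near-minimizers
    (hA3 : ∃ τ : ℝ, 0 < τ ∧ Bornology.IsBounded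
      ((fun θ : Θ => (θ : PRW.E m)) '' {θ : Θ |
        PRW.prw 1 1 (μs : Measure (PRW.E d)) (μ θ : Measure (PRW.E d)) ≤
          (⨅ θ' : Θ, PRW.prw 1 1 (μs : Measure (PRW.E d)) (μ θ' : Measure (PRW.E d)))
            + ENNReal.ofReal τ}))
    -- the model is well specified
    (θs : Θ) (hint : (θs : PRW.E m) ∈ interior Θ) (hspec : μs = μ θs)
    (hsep : PRW.WellSeparated μ θs)
    -- nonsingular norm derivative
    (D : PRW.Sph d → ℝ → PRW.E m) (hDmeas : Measurable (Function.uncurry D))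
    (hD : PRW.IsNormDerivative μ θs D) (hDns : PRW.Nonsingular D)
    -- weak limit of the empirical process
    {Ω' : Type*} [MeasurableSpace Ω'] (P' : Measure Ω') [IsProbabilityMeasure P']
    (G : Ω' → PRW.SpaceL d)
    (hG : PRW.WeakConvergenceL
      (fun n ω u t => √(n : ℝ) * (PRW.empCDF n (fun i => X i ω) u t
        - PRW.projCDF (μs : Measure (PRW.E d)) u t)) P G P') :
    -- goodness-of-fit statistic; both sides are finite
    ((∀ n : ℕ, 1 ≤ n → ∀ ω, (⨅ θ : Θ, PRW.prw 1 1 (PRW.empirical n (fun i => X i ω))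
        (μ θ : Measure (PRW.E d))) < ∞) ∧
      (∀ ω', (⨅ θ : PRW.E m, PRW.limitCriterion (G ω') D θ) < ∞) ∧
      TendstoInDistribution
        (fun (n : ℕ) ω => √(n : ℝ) * (⨅ θ : Θ, PRW.prw 1 1 (PRW.empirical n (fun i => X i ω))
          (μ θ : Measure (PRW.E d))).toReal)
        atTop
        (fun ω' => (⨅ θ : PRW.E m, PRW.limitCriterion (G ω') D θ).toReal)
        (fun _ => P) P') ∧
    -- the estimator
    ((∀ᵐ ω' ∂P', ∃! θ : PRW.E m, θ ∈ PRW.argmin (PRW.limitCriterion (G ω') D)) →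
      ∀ θhat : ℕ → Ω → Θ, (∀ n, Measurable (θhat n)) →
        (∀ n ω, (PRW.argmin (fun θ : Θ => PRW.prw 1 1 (PRW.empirical n (fun i => X i ω))
            (μ θ : Measure (PRW.E d)))).Nonempty →
          θhat n ω ∈ PRW.argmin (fun θ : Θ => PRW.prw 1 1 (PRW.empirical n (fun i => X i ω))
            (μ θ : Measure (PRW.E d)))) →
        ∀ Z : Ω' → PRW.E m,
          (∀ᵐ ω' ∂P', Z ω' ∈ PRW.argmin (PRW.limitCriterion (G ω') D)) →
          TendstoInDistribution
            (fun (n : ℕ) ω => √(n : ℝ) • ((θhat n ω : PRW.E m) - (θs : PRW.E m)))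
            atTop Z (fun _ => P) P') := by
  subst hspec
  obtain ⟨g, hg, hgG⟩ := hG
  -- Any sample point serves to supply the one-observation distribution function that bounds `D`.
  obtain ⟨ω₀⟩ : Nonempty Ω := nonempty_of_isProbabilityMeasure P
  have hDm : ∀ u, Measurable (D u) := fun u => hDmeas.comp measurable_prodMk_left
  obtain ⟨⟨B, hB0, hB⟩, c, hc0, hc⟩ :=
    PRW.exists_normL_inner_bounds hint hDm hD hDns (fun i => X i ω₀) (hg 1 ω₀)
  refine ⟨⟨fun n hn ω => ?_, fun ω' => PRW.iInf_limitCriterion_lt_top D (G ω'), ?_⟩,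
    fun huniq θhat hθm hθ Z hZ => ?_⟩
  · have h1 := PRW.iInf_scaledCriterion_lt_top (μ := μ) (θs := θs) √(n : ℝ) (g n ω)
    rw [PRW.iInf_scaledCriterion_eq (by omega) _ (hg n ω)] at h1
    exact ENNReal.lt_top_of_mul_ne_top_right h1.ne (PRW.ofReal_sqrt_natCast_ne_zero (by omega))
  · exact PRW.tendstoInDistribution_minValue μ θs hint hsep hDm hD hc0 hc hg hgG
  · exact PRW.tendstoInDistribution_minimizer μ hA2 hint hsep hDm hD hc0 hc hB0 hB hg hgG huniq
      hθm hθ hZ
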